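/- There is an absolute constant $C>0$ with the following property. Let $p\ge 1$, $m\ge 2$, $n\ge 1$ and consider $\min_{x\in\mathbb R^p}\sum_{i=1}^m f_{(i)}(x)$ with $f_{(i)}=\frac1n\sum_{j=1}^n f_{(i),j}$, where each $f_{(i)}$ is $L_{(i)}$-smooth and $\mu$-strongly convex ($\mu>0$) and each $f_{(i),j}$ is $L_{(i),j}$-smooth and convex ($L$-smooth: differentiable with $L$-Lipschitz gradient). Let $x^*$ be the minimizer, $L_f=\max_iL_{(i)}$, $\overline L_{(i)}=\frac1n\sum_jL_{(i),j}$, $\overline L_f=\max_i\overline L_{(i)}$, $\kappa_b=L_f/\mu$, $\kappa_s=\overline L_f/\mu$, where the constants are chosen with $L_{(i)}\le\overline L_{(i)}$ (always possible). Let $W\in\mathbb R^{m\times m}$ be a weight matrix of a connected undirected graph on the $m$ nodes: $W_{ij}\ne0$ iff $i=j$ or $i,j$ are neighbours, $W=W^T$, $I\succeq W\succeq0$, $W\mathbf 1=\mathbf 1$, and its second largest eigenvalue satisfies $\sigma_2(W)<1$. Put $\kappa_c=\frac1{1-\sigma_2(W)}$. Chebyshev matrix. Let $U^2=\frac{I-W}2$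 with eigenvalues $\lambda_1\ge\dots\ge\lambda_{m-1}>\lambda_m=0$, $\gamma=\lambda_{m-1}/\lambda_1$, $c_2=\frac{1+\gamma}{1-\gamma}$, $c_3=\frac2{\lambda_1+\lambda_{m-1}}$, $t=\lceil 3/\sqrt\gamma\,\rceil$, and $P_t(x)=1-\frac{T_t(c_2(1-x))}{T_t(c_2)}$ with $T_t$ the Chebyshev polynomial (for $\gamma=1$, $P_t(x)=1-(1-x)^t$, the limit). Let $M=\frac1{2.2}P_t(c_3U^2)$. Algorithm (Acc-VR-EXTRA-CA). Let $\kappa=3$ and assume $\kappa\le\kappa_b$ and $\kappa\le\max\{\frac{n\kappa_b}{\kappa_s},\frac{n^2\kappa_b}{\kappa_s^2}\}$ (there is no restriction on $\kappa_c$). Set $b=\Big\lceil\sqrt{\frac{n\max\{\overline L_f,n\mu\}}{\kappa L_f}}\Big\rceil$, $\theta_1=\frac12\sqrt{\frac{\kappa\mu}{L_f}}$, $\theta_2=\frac{\overline L_f}{2L_fb}$, $\alpha=\frac1{10L_f}$, $p_{(i),j}=\frac{L_{(i),j}}{\sum_{j'}L_{(i),j'}}$. Start from arbitrary $x^0_{(i)}=z^0_{(i)}=w^0_{(i)}$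 and $\widetilde\lambda^0_{(i)}=0$. For $k\ge0$ each node $i$ draws a multiset $\mathcal S_{(i)}^k$ of $b$ independent samples from $(p_{(i),j})_j$ and computes $$y_{(i)}^k=\theta_1z_{(i)}^k+\theta_2w_{(i)}^k+(1-\theta_1-\theta_2)x_{(i)}^k,$$ $$\nabla_{(i)}^k=\frac1b\sum_{j\in\mathcal S_{(i)}^k}\frac1{np_{(i),j}}\big(\nabla f_{(i),j}(y_{(i)}^k)-\nabla f_{(i),j}(w_{(i)}^k)\big)+\nabla f_{(i)}(w_{(i)}^k),$$ $$z_{(i)}^{k+1}=\frac1{1+\frac{\mu\alpha}{\theta_1}}\Big(\frac{\mu\alpha}{\theta_1}y_{(i)}^k+z_{(i)}^k-\frac1{\theta_1}\big(\alpha\nabla_{(i)}^k+\widetilde\lambda_{(i)}^k+\theta_1\textstyle\sum_jM_{ij}z_{(j)}^k\big)\Big),$$ $$\widetilde\lambda_{(i)}^{k+1}=\widetilde\lambda_{(i)}^k+\theta_1\textstyle\sum_jM_{ij}z_{(j)}^{k+1},\qquad x_{(i)}^{k+1}=y_{(i)}^k+\theta_1(z_{(i)}^{k+1}-z_{(i)}^k),$$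 and $w_{(i)}^{k+1}=x_{(i)}^{k+1}$ with probability $b/n$, $w_{(i)}^{k+1}=w_{(i)}^k$ otherwise, all random choices being independent. Costs. Applying $M$, a polynomial of degree at most $t$ in $W$, once takes $t$ communication rounds (one product with $W$ each), and each iteration applies $M$ to $z^k$ and to $z^{k+1}$. Each node makes $n$ component gradient evaluations at the start, $2b$ in each iteration, and $n$ more whenever it sets $w_{(i)}^{k+1}=x_{(i)}^{k+1}$. Conclusion. There is $\varepsilon_0>0$ (depending on the problem and the starting point) such that for every $0<\varepsilon<\varepsilon_0$ there is a $K$ with $\mathbb E\big[\sum_{i=1}^m\|z_{(i)}^k-x^*\|^2\big]\le\varepsilon$ for all $k\ge K$, such that the first $K$ iterations use at most $C\sqrt{\kappa_b\kappa_c}\,\log\frac1\varepsilon$ communication rounds and, for each node in expectation, at most $C(\sqrt{n\kappa_s}+n)\log\frac1\varepsilon$ stochastic gradient evaluations. -/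

import Mathlib

noncomputable section

namespace AccVRExtra

/-- `g` is `L`-smooth: differentiable, with `L`-Lipschitz gradient. -/
def IsSmoothWith {p : ℕ} (L : ℝ) (g : EuclideanSpace ℝ (Fin p) → ℝ) : Prop :=
  Differentiable ℝ g ∧ ∀ x y, ‖gradient g y - gradient g x‖ ≤ L * ‖y - x‖

/-- A stacked variable: row `i` is the vector held by node `i`. -/
abbrev Stack (m p : ℕ) : Type := Fin m → EuclideanSpace ℝ (Fin p)

/-- The product `M 𝐱` of an `m × m` matrix with a stacked variable. -/
def act {m p : ℕ} (M : Matrix (Fin m) (Fin m) ℝ) (x : Stack m p) : Stack m p :=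
  fun i => ∑ j, M i j • x j

/-- The `k`-th largest eigenvalue (counted with multiplicity, `k = 1, …, m`) of a symmetric
real matrix; the value `0` is a placeholder for other inputs. -/
def eig {m : ℕ} (A : Matrix (Fin m) (Fin m) ℝ) (k : ℕ) : ℝ :=
  open Classical in
  if h : A.IsHermitian ∧ 1 ≤ k ∧ k ≤ m then
    h.1.eigenvalues₀ ⟨k - 1, by rw [Fintype.card_fin]; omega⟩
  else 0

/-- Assumptions on the weight matrix `W` of the network `G` (with `ω = 0`). -/
structure IsGossipMatrix {m : ℕ} (G : SimpleGraph (Fin m)) (W : Matrix (Fin m) (Fin m) ℝ) :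
    Prop where
  /-- the network is connected -/
  connected : G.Connected
  /-- `W i j ≠ 0` exactly for neighbours and on the diagonal -/
  pattern : ∀ i j, W i j ≠ 0 ↔ (G.Adj i j ∨ i = j)
  /-- `W = Wᵀ` -/
  symm : W.IsSymm
  /-- `W ⪰ 0` -/
  nonneg : W.PosSemidef
  /-- `I ⪰ W` -/
  le_one : (1 - W).PosSemidef
  /-- `W 𝟏 = 𝟏` -/
  mulVec_one : W.mulVec 1 = 1
  /-- the second largest eigenvalue of `W` is smaller than `1` -/
  second_lt_one : eig W 2 < 1

/-- The condition number `κ_c = 1 / (1 - σ₂(W))` of the network. -/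
def kappaC {m : ℕ} (W : Matrix (Fin m) (Fin m) ℝ) : ℝ := 1 / (1 - eig W 2)

/-! ### Chebyshev acceleration -/

/-- `U² = (I - W) / 2`. -/
def Usq {m : ℕ} (W : Matrix (Fin m) (Fin m) ℝ) : Matrix (Fin m) (Fin m) ℝ :=
  (1 / 2 : ℝ) • (1 - W)

/-- `γ(A) = λ_{m-1}(A) / λ₁(A)`. -/
def gam {m : ℕ} (A : Matrix (Fin m) (Fin m) ℝ) : ℝ := eig A (m - 1) / eig A 1

/-- The polynomial `P_t(x) = 1 - T_t(c₂ (1 - x)) / T_t(c₂)` with `c₂ = (1 + γ) / (1 - γ)`.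
For `γ = 1`, where `c₂ = ∞`, it is the limit `1 - (1 - x) ^ t`. -/
def chebPoly (γ : ℝ) (t : ℕ) : Polynomial ℝ :=
  open Classical in
  if γ = 1 then 1 - (1 - Polynomial.X) ^ t
  else
    1 - Polynomial.C (((Polynomial.Chebyshev.T ℝ t).eval ((1 + γ) / (1 - γ)))⁻¹) *
      (Polynomial.Chebyshev.T ℝ t).comp
        (Polynomial.C ((1 + γ) / (1 - γ)) * (1 - Polynomial.X))

/-- The degree `t = 3 / √γ(U²)`, rounded up. -/
def chebDeg {m : ℕ} (W : Matrix (Fin m) (Fin m) ℝ) : ℕ := ⌈3 / √(gam (Usq W))⌉₊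

/-- The matrix `Û² = V̂² = P_t(c₃ U²) / 2.2` with `c₃ = 2 / (λ₁(U²) + λ_{m-1}(U²))`. -/
def chebMatrix {m : ℕ} (W : Matrix (Fin m) (Fin m) ℝ) : Matrix (Fin m) (Fin m) ℝ :=
  (1 / 2.2 : ℝ) •
    Polynomial.aeval ((2 / (eig (Usq W) 1 + eig (Usq W) (m - 1))) • Usq W)
      (chebPoly (gam (Usq W)) (chebDeg W))

/-! ### The problem and the parameters -/

/-- The data of the decentralized finite-sum problem with `m` nodes, `n` samples per node and
variables in `ℝᵖ`. -/
structure Problem (p m n : ℕ) where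
  /-- `f i j` is the `j`-th component function of node `i` -/
  f : Fin m → Fin n → EuclideanSpace ℝ (Fin p) → ℝ
  /-- smoothness constants of the local functions -/
  L : Fin m → ℝ
  /-- smoothness constants of the component functions -/
  Lc : Fin m → Fin n → ℝ
  /-- strong convexity constant -/
  μ : ℝ
  /-- weight matrix of the network -/
  W : Matrix (Fin m) (Fin m) ℝ

namespace Problem

variable {p m n : ℕ} (P : Problem p m n)

/-- The local function `f_i = (1/n) ∑_j f_{i,j}`. -/
def loc (i : Fin m) : EuclideanSpace ℝ (Fin p) → ℝ :=
  fun x => (1 / (n : ℝ)) * ∑ j, P.f i j x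

/-- `L̄_i = (1/n) ∑_j L_{i,j}`. -/
def Lbar (i : Fin m) : ℝ := (1 / (n : ℝ)) * ∑ j, P.Lc i j

/-- `L_f = max_i L_i`. -/
def Lf : ℝ := ⨆ i, P.L i

/-- `L̄_f = max_i L̄_i`. -/
def LbarF : ℝ := ⨆ i, P.Lbar i

/-- The batch condition number. -/
def kappaB : ℝ := P.Lf / P.μ

/-- The stochastic condition number. -/
def kappaS : ℝ := P.LbarF / P.μ

/-- Assumptions on the functions. The last field is the standing convention that the constant of
an average is not chosen larger than the average of the constants. -/
structure FunctionAssumptions : Prop where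
  mu_pos : 0 < P.μ
  loc_smooth : ∀ i, IsSmoothWith (P.L i) (P.loc i)
  loc_strong : ∀ i, StrongConvexOn Set.univ P.μ (P.loc i)
  comp_smooth : ∀ i j, IsSmoothWith (P.Lc i j) (P.f i j)
  comp_convex : ∀ i j, ConvexOn ℝ Set.univ (P.f i j)
  L_le_Lbar : ∀ i, P.L i ≤ P.Lbar i

/-- The mini-batch size `b = √(n max{L̄_f, nμ} / (κ L_f))` with `κ = 3`, rounded up. -/
def b : ℕ := ⌈√((n : ℝ) * max P.LbarF (n * P.μ) / (3 * P.Lf))⌉₊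

/-- `θ₁ = (1/2) √(κ μ / L_f)` with `κ = 3`. -/
def θ₁ : ℝ := 1 / 2 * √(3 * P.μ / P.Lf)

/-- `θ₂ = L̄_f / (2 L_f b)`. -/
def θ₂ : ℝ := P.LbarF / (2 * P.Lf * P.b)

/-- The step size `α = 1 / (10 L_f)`. -/
def α : ℝ := 1 / (10 * P.Lf)

/-! ### Randomness -/

/-- The sampling probability `p_{i,j} = L_{i,j} / ∑_j' L_{i,j'}`. -/
def prob (i : Fin m) (j : Fin n) : ℝ := P.Lc i j / ∑ j', P.Lc i j'

/-- The distribution `𝒟_i` on the samples of node `i`. -/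
def sampleLaw (i : Fin m) : MeasureTheory.Measure (Fin n) :=
  ∑ j, ENNReal.ofReal (P.prob i j) • MeasureTheory.Measure.dirac j

/-- The coin that decides whether a node refreshes its snapshot: `true` with probability `b/n`. -/
def coinLaw : MeasureTheory.Measure Bool :=
  ENNReal.ofReal ((P.b : ℝ) / n) • MeasureTheory.Measure.dirac true +
    ENNReal.ofReal (1 - (P.b : ℝ) / n) • MeasureTheory.Measure.dirac false

/-- The random choices of one iteration: for each node, `b` sample indices and a coin. -/
abbrev Draw : Type := Fin m → (Fin P.b → Fin n) × Bool

/-- The law of the random choices of one iteration: all choices are independent. -/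
def drawLaw : MeasureTheory.Measure P.Draw :=
  MeasureTheory.Measure.pi fun i =>
    (MeasureTheory.Measure.pi fun _ : Fin P.b => P.sampleLaw i).prod P.coinLaw

/-- The law of the random choices `ξᵏ` of the first `k` iterations, which are independent. -/
def historyLaw (k : ℕ) : MeasureTheory.Measure (Fin k → P.Draw) :=
  MeasureTheory.Measure.pi fun _ => P.drawLaw

/-! ### The algorithm -/

/-- The state of the algorithm, with counters for its two costs. -/
structure State (m p : ℕ) where
  x : Stack m p
  z : Stack m p
  w : Stack m p
  /-- the auxiliary variable `λ̃ = Û λ` -/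
  lam : Stack m p
  /-- number of communication rounds so far; in one round each node sends one vector to its
  neighbours, that is, one product with `W` is computed -/
  rounds : ℕ
  /-- number of component gradients evaluated so far by each node -/
  evals : Fin m → ℕ

/-- The initial state: `x⁰ = z⁰ = w⁰`, `λ⁰ = 0`; each node evaluates its full gradient at `w⁰`. -/
def init (x₀ : Stack m p) : State m p where
  x := x₀
  z := x₀
  w := x₀
  lam := 0
  rounds := 0
  evals := fun _ => n

/-- The mixing point `y`. -/
def yPt (s : State m p) : Stack m p :=
  fun i => P.θ₁ • s.z i + P.θ₂ • s.w i + (1 - P.θ₁ - P.θ₂) • s.x i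

/-- The mini-batch variance reduced gradient estimator. -/
def estimator (d : P.Draw) (s : State m p) : Stack m p :=
  fun i =>
    (1 / (P.b : ℝ)) • ∑ l : Fin P.b,
      (1 / ((n : ℝ) * P.prob i ((d i).1 l))) •
        (gradient (P.f i ((d i).1 l)) (P.yPt s i) - gradient (P.f i ((d i).1 l)) (s.w i))
      + gradient (P.loc i) (s.w i)

/-- The new `z`. -/
def zNext (d : P.Draw) (s : State m p) : Stack m p :=
  fun i =>
    (1 / (1 + P.μ * P.α / P.θ₁)) •
      ((P.μ * P.α / P.θ₁) • P.yPt s i + s.z i -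
        (1 / P.θ₁) • (P.α • P.estimator d s i + s.lam i
          + P.θ₁ • act (chebMatrix P.W) s.z i))

/-- The new `x`. -/
def xNext (d : P.Draw) (s : State m p) : Stack m p :=
  fun i => P.yPt s i + P.θ₁ • (P.zNext d s i - s.z i)

/-- One iteration of Acc-VR-EXTRA with Chebyshev acceleration.
Costs: the matrix `P_t(c₃ U²) / 2.2`, a polynomial of degree at most `t` in `W`, is applied to `z`
and to the new `z`, and each application takes `t` communication rounds; each node evaluates `b`
component gradients at `y` and `b` at `w`, and `n` more if it refreshes its snapshot. -/
def step (d : P.Draw) (s : State m p) : State m p where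
  x := P.xNext d s
  z := P.zNext d s
  w := fun i => if (d i).2 = true then P.xNext d s i else s.w i
  lam := fun i => s.lam i + P.θ₁ • act (chebMatrix P.W) (P.zNext d s) i
  rounds := s.rounds + 2 * chebDeg P.W
  evals := fun i => s.evals i + 2 * P.b + (if (d i).2 = true then n else 0)

/-- The state after `k` iterations, as a function of the random choices. -/
def run (x₀ : Stack m p) : (k : ℕ) → (Fin k → P.Draw) → State m p
  | 0, _ => init (n := n) x₀
  | k + 1, ω => P.step (ω (Fin.last k)) (run x₀ k fun t => ω t.castSucc)

/-- The expectation of a function of the state after `k` iterations. -/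
def expect (x₀ : Stack m p) (k : ℕ) (g : State m p → ℝ) : ℝ :=
  ∫ ω, g (P.run x₀ k ω) ∂(P.historyLaw k)

end Problem

end AccVRExtra

end

noncomputable section

/-! ### Chebyshev polynomials: how far `chebPoly` flattens a spectrum. -/

namespace AccVRExtra

/-! Stack the nodes' vectors. Consensus is the kernel of M = `chebMatrix W`, and the algorithm is an
accelerated, linearized primal-dual method for minimizing F(u) = ∑ f_i(u_i) subject to Mu = 0.

Communication. Since T_t(cosh a) = cosh(ta), a degree t ≥ 3/√γ gives T_t(c₂) ≥ 11, so off consensus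
the eigenvalues of M lie in [2/5, 1/2] (`chebMatrix_spectrum`). The network thus affects the
iteration only through absolute constants, at the price of t ≤ 4√κ_c products with W per application
of M (`chebDeg_le`).

Convergence. The Lyapunov function `lyap` combines the Bregman distances of x and of the snapshot w
to the solution, the dual error in the norm of a pseudo-inverse R of M, and the error of z in the
norm of I - M. `step_descent` and `lyapunov_combine` contract it by 1/(1 + θ₁/50) up to noise. The
dual part contracts although nothing is strongly concave in the dual: the optimality condition of
the z-step expresses the new dual error through quantities whose squares were left over in the
descent estimate. In expectation the linear noise vanishes. Importance sampling and cocoercivity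
bound the variance by (2 L̄_f/b) D(w, y), and θ₂ is exactly the value for which the descent term -θ₂
D(w, y) cancels its contribution (`integral_lyap_step_le`). Snapshots are fresh enough because b/n ≥
(2/3) max(θ₁, θ₂).

Counting. As 1/θ₁ ≤ 2√κ_b, O(√κ_b log(1/ε)) iterations suffice. Each costs 2t rounds and on average
3b gradients, and b√κ_b ≤ 2(√(nκ_s) + n) (`parameterBounds`). -/

open Polynomial in
/-- Growth of the Chebyshev polynomials outside `[-1, 1]`. -/
lemma eleven_le_chebyshevT {γ : ℝ} (h0 : 0 < γ) (h1 : γ < 1) {t : ℕ} (ht : 3 ≤ t * √γ) :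
    11 ≤ (Polynomial.Chebyshev.T ℝ t).eval ((1 + γ) / (1 - γ)) := by
  set s := √γ with hs
  have hs0 : 0 < s := Real.sqrt_pos.2 h0
  have hsq : s ^ 2 = γ := Real.sq_sqrt h0.le
  have hs1 : s < 1 := by nlinarith
  -- With s = √γ, cosh a = (1 + s²)/(1 - s²) is c₂, so T_t(c₂) = cosh(ta).
  set a := Real.log ((1 + s) / (1 - s)) with ha
  have hpos : 0 < (1 + s) / (1 - s) := div_pos (by linarith) (by linarith)
  have hcosh : Real.cosh a = (1 + γ) / (1 - γ) := by
    have h3 : (1 - s) ≠ 0 := by linarith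
    have h4 : (1 + s) ≠ 0 := by linarith
    have h5 : (1 - s ^ 2) ≠ 0 := by nlinarith
    rw [Real.cosh_eq, Real.exp_neg, ha, Real.exp_log hpos, ← hsq]
    field_simp
    ring
  -- Crude logarithm bounds suffice: they give ta ≥ 9/2 ≥ 4, and cosh 4 > e⁴/2 ≥ 11.
  have hlog : 3 / 2 * s ≤ a := by
    rw [ha, Real.log_div (by linarith) (by linarith)]
    have e1 : Real.log (1 - s) ≤ -s := by
      have := Real.log_le_sub_one_of_pos (show (0 : ℝ) < 1 - s by linarith); linarith
    have e2 : s / 2 ≤ Real.log (1 + s) := by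
      have := Real.one_sub_inv_le_log_of_pos (show (0 : ℝ) < 1 + s by linarith)
      refine le_trans ?_ this
      have : 1 - (1 + s)⁻¹ = s / (1 + s) := by field_simp; ring
      rw [this]
      exact div_le_div_of_nonneg_left hs0.le (by linarith) (by linarith)
    linarith
  have hbig : 4 ≤ (t : ℝ) * a := by
    have : (t : ℝ) * (3 / 2 * s) ≤ t * a := by gcongr
    nlinarith
  rw [← hcosh, Polynomial.Chebyshev.T_real_cosh, Real.cosh_eq]
  have e4 : Real.exp 4 ≤ Real.exp (((t : ℤ) : ℝ) * a) := by
    apply Real.exp_le_exp.2; push_cast; exact hbig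
  have e5 : (22 : ℝ) ≤ Real.exp 4 := by
    have h := Real.exp_one_gt_d9
    have : Real.exp 4 = Real.exp 1 ^ 4 := by rw [← Real.exp_nat_mul]; norm_num
    rw [this]
    have : (2.7 : ℝ) ^ 4 ≤ Real.exp 1 ^ 4 := by gcongr; linarith
    norm_num at this ⊢; linarith
  have := Real.exp_pos (-(((t : ℤ) : ℝ) * a))
  linarith

lemma chebPoly_eval_zero {γ : ℝ} (h0 : 0 < γ) (h1 : γ ≤ 1) (t : ℕ) :
    (chebPoly γ t).eval 0 = 0 := by
  unfold chebPoly
  split_ifs with h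
  · simp
  · have h1' : γ < 1 := lt_of_le_of_ne h1 h
    have : (1 : ℝ) ≤ (Polynomial.Chebyshev.T ℝ t).eval ((1 + γ) / (1 - γ)) :=
      Polynomial.Chebyshev.one_le_eval_T_real t (by rw [le_div_iff₀] <;> linarith)
    simp only [Polynomial.eval_sub, Polynomial.eval_one, Polynomial.eval_mul, Polynomial.eval_C,
      Polynomial.eval_comp, Polynomial.eval_X, sub_zero, mul_one]
    rw [inv_mul_cancel₀ (by linarith), sub_self]

/-- The interval is c₃ · [λ_{m-1}, λ₁]. On it c₂(1 - x) stays in [-1, 1], where |T_t| ≤ 1, while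
T_t(c₂) ≥ 11. For γ = 1 it shrinks to the point 1 and only t ≠ 0 matters. -/
lemma abs_chebPoly_eval_sub_one_le {γ : ℝ} (h0 : 0 < γ) (h1 : γ ≤ 1) {t : ℕ} (ht : 3 ≤ t * √γ)
    {x : ℝ} (hx : 2 * γ / (1 + γ) ≤ x) (hx' : x ≤ 2 / (1 + γ)) :
    |(chebPoly γ t).eval x - 1| ≤ 1 / 10 := by
  unfold chebPoly
  split_ifs with h
  · subst h
    have : x = 1 := by norm_num at hx hx'; linarith
    have h0 : t ≠ 0 := by rintro rfl; norm_num at ht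
    subst this
    simp [h0]
  · have h1' : γ < 1 := lt_of_le_of_ne h1 h
    have h11 := eleven_le_chebyshevT h0 h1' ht
    simp only [Polynomial.eval_sub, Polynomial.eval_one, Polynomial.eval_mul, Polynomial.eval_C,
      Polynomial.eval_comp, Polynomial.eval_X]
    set T := (Polynomial.Chebyshev.T ℝ t).eval ((1 + γ) / (1 - γ))
    have hT : |(Polynomial.Chebyshev.T ℝ t).eval ((1 + γ) / (1 - γ) * (1 - x))| ≤ 1 := by
      apply Polynomial.Chebyshev.abs_eval_T_real_le_one
      rw [div_le_iff₀ (by linarith)] at hx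
      rw [le_div_iff₀ (by linarith)] at hx'
      rw [abs_le]
      constructor
      · rw [div_mul_eq_mul_div, le_div_iff₀ (by linarith)]; nlinarith
      · rw [div_mul_eq_mul_div, div_le_iff₀ (by linarith)]; nlinarith
    rw [sub_sub_cancel_left, abs_neg, abs_mul, abs_inv, abs_of_pos (by linarith : 0 < T)]
    calc T⁻¹ * _ ≤ 10⁻¹ * 1 := by gcongr; linarith
      _ = _ := by norm_num

end AccVRExtra

/-! ### The spectrum of U² and its relation to κ_c. -/

namespace AccVRExtra

open Matrix

section Spectrum

variable {m : ℕ}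

lemma mulVec_eq_zero_of_mulVec_one {W : Matrix (Fin m) (Fin m) ℝ} (h : W.mulVec 1 = 1) :
    (Usq W).mulVec 1 = 0 := by
  rw [Usq, smul_mulVec, sub_mulVec, h, one_mulVec, sub_self, smul_zero]

lemma dotProduct_eq_zero_of_eigenvalue_lt {W : Matrix (Fin m) (Fin m) ℝ} (hW : W.IsHermitian)
    {v : Fin m → ℝ} {c : ℝ} (hv : W.mulVec v = c • v) {j : Fin m} (hj : hW.eigenvalues j < c) :
    inner ℝ (hW.eigenvectorBasis j) (WithLp.toLp 2 v) = 0 := by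
  have h1 : (hW.eigenvectorBasis j).ofLp ⬝ᵥ W.mulVec v
      = (W.mulVec (hW.eigenvectorBasis j).ofLp) ⬝ᵥ v := by
    rw [dotProduct_mulVec, ← mulVec_transpose]
    have : Wᵀ = W := by rwa [← conjTranspose_eq_transpose_of_trivial]
    rw [this]
  rw [hv, hW.mulVec_eigenvectorBasis, dotProduct_smul, smul_dotProduct, smul_eq_mul,
    smul_eq_mul] at h1
  have h2 : (hW.eigenvectorBasis j).ofLp ⬝ᵥ v = 0 := by
    have : (c - hW.eigenvalues j) * ((hW.eigenvectorBasis j).ofLp ⬝ᵥ v) = 0 := by linarith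
    exact (mul_eq_zero.1 this).resolve_left (by linarith)
  rw [EuclideanSpace.inner_eq_star_dotProduct, dotProduct_comm]
  simpa using h2

/-- Unit vectors in an eigenspace beyond the second eigenvalue are not orthogonal. -/
lemma inner_ne_zero_of_second_lt {W : Matrix (Fin m) (Fin m) ℝ} (hW : W.IsHermitian) (hm : 2 ≤ m)
    {u v : EuclideanSpace ℝ (Fin m)} {c d : ℝ} (hu : W.mulVec u.ofLp = c • u.ofLp)
    (hv : W.mulVec v.ofLp = d • v.ofLp) (hc : eig W 2 < c) (hd : eig W 2 < d)
    (hu1 : u ≠ 0) (hv1 : v ≠ 0) : inner ℝ u v ≠ 0 := by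
  set e := Fintype.equivOfCardEq (Fintype.card_fin (Fintype.card (Fin m))) with he
  set j₀ : Fin m := e ⟨0, by rw [Fintype.card_fin]; omega⟩ with hj₀
  have hle : ∀ j, j ≠ j₀ → hW.eigenvalues j ≤ eig W 2 := by
    intro j hj
    rw [eig, dif_pos ⟨hW, by norm_num, hm⟩]
    apply hW.eigenvalues₀_antitone
    rw [Fin.le_def]
    have : e.symm j ≠ ⟨0, by rw [Fintype.card_fin]; omega⟩ := by
      intro h
      exact hj (by rw [hj₀, ← h, Equiv.apply_symm_apply])
    have h3 : (e.symm j).val ≠ 0 := fun h => this (Fin.ext h)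
    have h4 : 1 ≤ (e.symm j).val := by omega
    exact h4
  -- An eigenvector beyond `eig W 2` is orthogonal to every basis vector except the top one, so it
  -- lies on the line of `j₀`.
  have key : ∀ {u : EuclideanSpace ℝ (Fin m)} {c : ℝ}, W.mulVec u.ofLp = c • u.ofLp →
      eig W 2 < c → u = (inner ℝ (hW.eigenvectorBasis j₀) u) • hW.eigenvectorBasis j₀ := by
    intro u c hu hc
    conv_lhs => rw [← hW.eigenvectorBasis.sum_repr' u]
    refine Finset.sum_eq_single j₀ (fun j _ hj => ?_) (by simp)
    have := dotProduct_eq_zero_of_eigenvalue_lt hW hu (lt_of_le_of_lt (hle j hj) hc)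
    rw [this, zero_smul]
  have k1 := key hu hc
  have k2 := key hv hd
  set a := inner ℝ (hW.eigenvectorBasis j₀) u
  set b := inner ℝ (hW.eigenvectorBasis j₀) v
  rw [k1, k2, inner_smul_left, inner_smul_right, real_inner_self_eq_norm_sq,
    hW.eigenvectorBasis.orthonormal.1]
  have ha : a ≠ 0 := by rintro h; rw [h, zero_smul] at k1; exact hu1 k1
  have hb : b ≠ 0 := by rintro h; rw [h, zero_smul] at k2; exact hv1 k2
  simp [ha, hb]

variable {G : SimpleGraph (Fin m)} {W : Matrix (Fin m) (Fin m) ℝ}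

lemma IsGossipMatrix.posSemidef_Usq (hW : IsGossipMatrix G W) : (Usq W).PosSemidef :=
  hW.le_one.smul (by norm_num)

lemma one_sub_two_Usq (W : Matrix (Fin m) (Fin m) ℝ) : (1 : Matrix (Fin m) (Fin m) ℝ) - (2 : ℝ) • Usq W = W := by
  rw [Usq, smul_smul]; norm_num

/-- The spectrum of `U²`: a simple eigenvalue `0`, the other ones between `λ_{m-1}` and `λ₁`. -/
lemma IsGossipMatrix.eigenvalues_Usq (hW : IsGossipMatrix G W) (hm : 2 ≤ m)
    (hA : (Usq W).IsHermitian) :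
    ∃ i₀, hA.eigenvalues i₀ = 0 ∧ (∀ i, i ≠ i₀ → eig (Usq W) (m - 1) ≤ hA.eigenvalues i ∧
      hA.eigenvalues i ≤ eig (Usq W) 1) ∧ (1 - eig W 2) / 2 ≤ eig (Usq W) (m - 1) ∧
      eig (Usq W) (m - 1) ≤ eig (Usq W) 1 ∧ eig (Usq W) 1 ≤ 1 / 2 := by
  set e := Fintype.equivOfCardEq (Fintype.card_fin (Fintype.card (Fin m))) with he
  have hc : Fintype.card (Fin m) = m := Fintype.card_fin m
  have eig_eq : ∀ k (hk : 1 ≤ k ∧ k ≤ m), eig (Usq W) k =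
      hA.eigenvalues (e ⟨k - 1, by omega⟩) := by
    intro k hk
    rw [eig, dif_pos ⟨hA, hk⟩, IsHermitian.eigenvalues, Equiv.symm_apply_apply]
  have hnn : ∀ i, 0 ≤ hA.eigenvalues i := hW.posSemidef_Usq.eigenvalues_nonneg
  have anti : ∀ i j, (e.symm i).val ≤ (e.symm j).val → hA.eigenvalues j ≤ hA.eigenvalues i :=
    fun i j h => hA.eigenvalues₀_antitone h
  set i₀ := e ⟨m - 1, by omega⟩ with hi₀
  -- U² is singular because it kills 𝟏; its eigenvalues are nonnegative and sorted decreasingly, so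
  -- the last one is 0.
  have hz : hA.eigenvalues i₀ = 0 := by
    have hdet : (Usq W).det = 0 := by
      rw [← Matrix.exists_mulVec_eq_zero_iff]
      refine ⟨1, ?_, mulVec_eq_zero_of_mulVec_one hW.mulVec_one⟩
      intro h
      have := congrFun h ⟨0, by omega⟩
      simp at this
    rw [hA.det_eq_prod_eigenvalues] at hdet
    obtain ⟨j, -, hj⟩ := Finset.prod_eq_zero_iff.1 hdet
    have hj : hA.eigenvalues j = 0 := by simpa using hj
    apply le_antisymm _ (hnn _)
    rw [← hj]
    apply anti
    rw [hi₀, Equiv.symm_apply_apply]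
    have := (e.symm j).isLt
    change (e.symm j).val ≤ m - 1
    omega
  have hWvec : ∀ i, W.mulVec (hA.eigenvectorBasis i).ofLp =
      (1 - 2 * hA.eigenvalues i) • (hA.eigenvectorBasis i).ofLp := by
    intro i
    have h : ∀ q, W.mulVec q = q - (2 : ℝ) • (Usq W).mulVec q := fun q => by
      rw [← smul_mulVec, ← one_mulVec q, mulVec_mulVec, mulVec_mulVec, ← sub_mulVec, mul_one,
        mul_one, one_sub_two_Usq]
    rw [h, hA.mulVec_eigenvectorBasis, sub_smul, one_smul, smul_smul]
  have hhalf : ∀ i, hA.eigenvalues i ≤ 1 / 2 := by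
    intro i
    have h1 := hW.nonneg.dotProduct_mulVec_nonneg (hA.eigenvectorBasis i).ofLp
    rw [hWvec, dotProduct_smul] at h1
    have h2 : star (hA.eigenvectorBasis i).ofLp ⬝ᵥ (hA.eigenvectorBasis i).ofLp = 1 := by
      rw [dotProduct_comm, ← EuclideanSpace.inner_eq_star_dotProduct, real_inner_self_eq_norm_sq,
        hA.eigenvectorBasis.orthonormal.1]; norm_num
    rw [h2] at h1
    simp at h1
    linarith
  have hne : ∀ i, hA.eigenvectorBasis i ≠ 0 := fun i h => by
    have := hA.eigenvectorBasis.orthonormal.1 i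
    rw [h] at this; simp at this
  refine ⟨i₀, hz, ?_, ?_, ?_, ?_⟩
  · intro i hi
    rw [eig_eq (m - 1) (by omega), eig_eq 1 (by omega)]
    constructor
    · apply anti
      rw [Equiv.symm_apply_apply]
      have h1 := (e.symm i).isLt
      have h2 : (e.symm i).val ≠ m - 1 := fun h =>
        hi (by rw [hi₀, ← e.apply_symm_apply i]; exact congrArg e (Fin.ext h))
      change (e.symm i).val ≤ m - 1 - 1
      omega
    · apply anti
      rw [Equiv.symm_apply_apply]
      exact Nat.zero_le _
  · rw [eig_eq (m - 1) (by omega)]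
    -- Otherwise W would have two orthogonal eigenvectors with eigenvalues above σ₂, one for 0 and
    -- one for λ_{m-1}. Indices are zero-based, so λ_{m-1} sits at m - 1 - 1.
    by_contra hlt
    push Not at hlt
    have hs := hW.second_lt_one
    set i₁ := e ⟨m - 1 - 1, by omega⟩ with hi₁
    refine inner_ne_zero_of_second_lt hW.nonneg.1 hm (hWvec i₀) (hWvec i₁) ?_ ?_ (hne _) (hne _)
      (hA.eigenvectorBasis.orthonormal.2 ?_)
    · rw [hz]; linarith
    · linarith
    · intro h
      have := congrArg Fin.val (e.injective h)
      simp at this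
      omega
  · rw [eig_eq (m - 1) (by omega), eig_eq 1 (by omega)]
    apply anti
    rw [Equiv.symm_apply_apply]
    exact Nat.zero_le _
  · rw [eig_eq 1 (by omega)]; exact hhalf _

end Spectrum
-- The Chebyshev matrix: conditioning, degree and pseudo-inverse.
section ChebMatrix

variable {m : ℕ} {G : SimpleGraph (Fin m)} {W : Matrix (Fin m) (Fin m) ℝ}

/-- Hermitian functional calculus in the eigenbasis of `A`. -/
def specDiag {A : Matrix (Fin m) (Fin m) ℝ} (hA : A.IsHermitian) :
    (Fin m → ℝ) →ₐ[ℝ] Matrix (Fin m) (Fin m) ℝ :=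
  (Unitary.conjStarAlgAut ℝ _ hA.eigenvectorUnitary).toAlgEquiv.toAlgHom.comp (diagonalAlgHom ℝ)

lemma specDiag_apply {A : Matrix (Fin m) (Fin m) ℝ} (hA : A.IsHermitian) (d : Fin m → ℝ) :
    specDiag hA d = (hA.eigenvectorUnitary : Matrix (Fin m) (Fin m) ℝ) * diagonal d *
      (hA.eigenvectorUnitary : Matrix (Fin m) (Fin m) ℝ)ᴴ := rfl

lemma specDiag_eigenvalues {A : Matrix (Fin m) (Fin m) ℝ} (hA : A.IsHermitian) :
    specDiag hA hA.eigenvalues = A := by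
  conv_rhs => rw [hA.spectral_theorem]
  rfl

lemma posSemidef_specDiag {A : Matrix (Fin m) (Fin m) ℝ} (hA : A.IsHermitian) {d : Fin m → ℝ}
    (hd : ∀ i, 0 ≤ d i) : (specDiag hA d).PosSemidef := by
  rw [specDiag_apply]
  exact (PosSemidef.diagonal hd).mul_mul_conjTranspose_same _

lemma specDiag_single_mulVec {A : Matrix (Fin m) (Fin m) ℝ} (hA : A.IsHermitian) (i : Fin m)
    (v : Fin m → ℝ) : (specDiag hA (Pi.single i 1)).mulVec v =
      ((hA.eigenvectorBasis i).ofLp ⬝ᵥ v) • (hA.eigenvectorBasis i).ofLp := by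
  rw [specDiag_apply, ← mulVec_mulVec, ← mulVec_mulVec]
  have : (diagonal (Pi.single i (1 : ℝ))).mulVec
      ((hA.eigenvectorUnitary : Matrix (Fin m) (Fin m) ℝ)ᴴ.mulVec v) =
      ((hA.eigenvectorBasis i).ofLp ⬝ᵥ v) • Pi.single i 1 := by
    ext j
    rw [mulVec_diagonal]
    by_cases h : j = i
    · subst h
      simp [mulVec, dotProduct]
    · simp [h]
  rw [this, mulVec_smul, hA.eigenvectorUnitary_mulVec]

lemma chebMatrix_eq_specDiag (hA : (Usq W).IsHermitian) :
    chebMatrix W = specDiag hA fun i => 1 / 2.2 * (chebPoly (gam (Usq W)) (chebDeg W)).eval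
      (2 / (eig (Usq W) 1 + eig (Usq W) (m - 1)) * hA.eigenvalues i) := by
  set c := 2 / (eig (Usq W) 1 + eig (Usq W) (m - 1)) with hc
  have h1 : c • Usq W = specDiag hA (c • hA.eigenvalues) := by
    rw [map_smul, specDiag_eigenvalues]
  rw [chebMatrix, ← hc, h1, Polynomial.aeval_algHom_apply, ← map_smul]
  congr 1
  ext i
  simp [Polynomial.aeval_fn_apply]

lemma IsGossipMatrix.one_le_kappaC (hW : IsGossipMatrix G W) (hm : 2 ≤ m) : 1 ≤ kappaC W := by
  have h := hW.second_lt_one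
  have h0 : 0 ≤ eig W 2 := by
    rw [eig, dif_pos ⟨hW.nonneg.1, by norm_num, hm⟩]
    have := hW.nonneg.eigenvalues_nonneg
      (Fintype.equivOfCardEq (Fintype.card_fin (Fintype.card (Fin m)))
        ⟨1, by rw [Fintype.card_fin]; omega⟩)
    rwa [IsHermitian.eigenvalues, Equiv.symm_apply_apply] at this
  rw [kappaC, le_div_iff₀ (by linarith)]
  linarith

/-- W ⪰ 0 gives λ₁ ≤ 1/2, and λ_{m-1} ≥ (1 - σ₂)/2, hence γ ≥ 1 - σ₂. -/
lemma IsGossipMatrix.gam_bounds (hW : IsGossipMatrix G W) (hm : 2 ≤ m) :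
    0 < gam (Usq W) ∧ gam (Usq W) ≤ 1 ∧ 1 / gam (Usq W) ≤ kappaC W := by
  obtain ⟨i₀, -, -, h3, h4, h5⟩ := hW.eigenvalues_Usq hm hW.posSemidef_Usq.1
  have h := hW.second_lt_one
  rw [gam, kappaC]
  refine ⟨div_pos (by linarith) (by linarith), (div_le_one (by linarith)).2 h4, ?_⟩
  rw [one_div_div, div_le_div_iff₀ (by linarith) (by linarith)]
  nlinarith

lemma IsGossipMatrix.three_le_chebDeg_mul_sqrt (hW : IsGossipMatrix G W) (hm : 2 ≤ m) :
    3 ≤ chebDeg W * √(gam (Usq W)) := by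
  have h := Real.sqrt_pos.2 (hW.gam_bounds hm).1
  rw [← div_le_iff₀ h]
  exact Nat.le_ceil _

/-- Because κ_c ≥ 1, rounding up is absorbed: 3√κ_c + 1 ≤ 4√κ_c. -/
lemma IsGossipMatrix.chebDeg_le (hW : IsGossipMatrix G W) (hm : 2 ≤ m) :
    (chebDeg W : ℝ) ≤ 4 * √(kappaC W) := by
  obtain ⟨h1, h2, h3⟩ := hW.gam_bounds hm
  have h4 : (chebDeg W : ℝ) < 3 / √(gam (Usq W)) + 1 := Nat.ceil_lt_add_one (by positivity)
  have h5 : 1 ≤ √(kappaC W) := Real.one_le_sqrt.2 (hW.one_le_kappaC hm)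
  have h6 : 1 / √(gam (Usq W)) ≤ √(kappaC W) := by
    rw [← Real.sqrt_one, ← Real.sqrt_div zero_le_one]
    exact Real.sqrt_le_sqrt h3
  have h7 : 3 / √(gam (Usq W)) = 3 * (1 / √(gam (Usq W))) := by ring
  linarith

/-- The Chebyshev matrix vanishes on consensus and is well conditioned on its complement. -/
theorem IsGossipMatrix.chebMatrix_spectrum (hW : IsGossipMatrix G W) (hm : 2 ≤ m) :
    (chebMatrix W).PosSemidef ∧ ((1 / 2 : ℝ) • 1 - chebMatrix W).PosSemidef ∧
    ((2 : ℝ) • chebMatrix W - chebMatrix W * chebMatrix W).PosSemidef ∧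
    (chebMatrix W).mulVec 1 = 0 ∧
    ∃ R : Matrix (Fin m) (Fin m) ℝ, R.PosSemidef ∧ ((5 / 2 : ℝ) • 1 - R).PosSemidef ∧
      ∀ v : Fin m → ℝ, ∑ i, v i = 0 → (chebMatrix W * R).mulVec v = v := by
  have hA := hW.posSemidef_Usq.1
  obtain ⟨i₀, h0, h1, h2, h3, h4⟩ := hW.eigenvalues_Usq hm hA
  obtain ⟨g1, g2, -⟩ := hW.gam_bounds hm
  have hs := hW.second_lt_one
  rw [chebMatrix_eq_specDiag hA]
  set d : Fin m → ℝ := fun i => 1 / 2.2 * (chebPoly (gam (Usq W)) (chebDeg W)).eval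
      (2 / (eig (Usq W) 1 + eig (Usq W) (m - 1)) * hA.eigenvalues i) with hd
  have hd0 : d i₀ = 0 := by
    simp only [hd]; rw [h0, mul_zero, chebPoly_eval_zero g1 g2, mul_zero]
  -- The polynomial lies in [0.9, 1.1] there; 1.1/2.2 = 1/2 and 0.9/2.2 > 2/5.
  have hdi : ∀ i, i ≠ i₀ → 2 / 5 ≤ d i ∧ d i ≤ 1 / 2 := by
    intro i hi
    obtain ⟨a1, a2⟩ := h1 i hi
    have := abs_chebPoly_eval_sub_one_le g1 g2 (hW.three_le_chebDeg_mul_sqrt hm)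
      (x := 2 / (eig (Usq W) 1 + eig (Usq W) (m - 1)) * hA.eigenvalues i) ?_ ?_
    · rw [abs_le] at this
      simp only [hd]
      norm_num at this ⊢
      constructor <;> linarith
    · have : 2 * gam (Usq W) / (1 + gam (Usq W)) =
          2 / (eig (Usq W) 1 + eig (Usq W) (m - 1)) * eig (Usq W) (m - 1) := by
        have b1 : eig (Usq W) 1 ≠ 0 := by linarith
        have b2 : eig (Usq W) 1 + eig (Usq W) (m - 1) ≠ 0 := by linarith
        rw [gam]; field_simp
      rw [this]
      have : 0 < eig (Usq W) 1 + eig (Usq W) (m - 1) := by linarith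
      gcongr
    · have : 2 / (1 + gam (Usq W)) =
          2 / (eig (Usq W) 1 + eig (Usq W) (m - 1)) * eig (Usq W) 1 := by
        have b1 : eig (Usq W) 1 ≠ 0 := by linarith
        have b2 : eig (Usq W) 1 + eig (Usq W) (m - 1) ≠ 0 := by linarith
        rw [gam]; field_simp
      rw [this]
      have : 0 < eig (Usq W) 1 + eig (Usq W) (m - 1) := by linarith
      gcongr
  have hd' : ∀ i, 0 ≤ d i ∧ d i ≤ 1 / 2 := by
    intro i
    by_cases hi : i = i₀
    · rw [hi, hd0]; norm_num
    · have := hdi i hi; constructor <;> linarith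
  -- M is a multiple of U² in the functional calculus, because its symbol vanishes where that of U²
  -- does.
  have hM1 : (specDiag hA d).mulVec 1 = 0 := by
    have hdl : d = (fun i => d i * (hA.eigenvalues i)⁻¹) * hA.eigenvalues := by
      ext i
      by_cases hi : i = i₀
      · rw [Pi.mul_apply, hi, hd0, h0]; simp
      · have : hA.eigenvalues i ≠ 0 := by have := (h1 i hi).1; linarith
        rw [Pi.mul_apply, mul_assoc, inv_mul_cancel₀ this, mul_one]
    rw [hdl, map_mul, specDiag_eigenvalues, ← mulVec_mulVec,
      mulVec_eq_zero_of_mulVec_one hW.mulVec_one, mulVec_zero]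
  -- `d⁻¹` is the pointwise inverse with 0⁻¹ = 0, so R is the pseudo-inverse of M, bounded by 5/2
  -- since the nonzero d are at least 2/5.
  refine ⟨posSemidef_specDiag hA fun i => (hd' i).1, ?_, ?_, hM1, specDiag hA d⁻¹, ?_, ?_, ?_⟩
  · rw [← map_one (specDiag hA), ← map_smul, ← map_sub]
    refine posSemidef_specDiag hA fun i => ?_
    have := (hd' i).2
    simp; linarith
  · rw [← map_smul, ← map_mul, ← map_sub]
    refine posSemidef_specDiag hA fun i => ?_
    have := hd' i
    simp only [Pi.sub_apply, Pi.smul_apply, smul_eq_mul, Pi.mul_apply]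
    nlinarith
  · exact posSemidef_specDiag hA fun i => inv_nonneg.2 (hd' i).1
  · rw [← map_one (specDiag hA), ← map_smul, ← map_sub]
    refine posSemidef_specDiag hA fun i => ?_
    simp only [Pi.sub_apply, Pi.smul_apply, Pi.one_apply, smul_eq_mul, mul_one, Pi.inv_apply,
      sub_nonneg]
    by_cases hi : i = i₀
    · rw [hi, hd0]; norm_num
    · have := (hdi i hi).1
      rw [inv_le_comm₀ (by linarith) (by norm_num)]
      norm_num; linarith
  · intro v hv
    have hP : (1 : Matrix (Fin m) (Fin m) ℝ) - specDiag hA d * specDiag hA d⁻¹ =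
        specDiag hA (Pi.single i₀ 1) := by
      rw [← map_one (specDiag hA), ← map_mul, ← map_sub]
      congr 1
      ext i
      by_cases hi : i = i₀
      · subst hi; simp [hd0]
      · have : d i ≠ 0 := by have := (hdi i hi).1; linarith
        simp [this, hi]
    -- 1 - MR projects onto the eigenvector of `i₀` and fixes 𝟏. So this eigenvector is parallel to
    -- 𝟏, and vectors of sum zero are killed by the projection.
    have hq : ((hA.eigenvectorBasis i₀).ofLp ⬝ᵥ 1) • (hA.eigenvectorBasis i₀).ofLp = 1 := by
      rw [← specDiag_single_mulVec, ← hP, ← map_mul, mul_comm, map_mul, sub_mulVec,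
        ← mulVec_mulVec, hM1, mulVec_zero,
        one_mulVec, sub_zero]
    have hqv : (hA.eigenvectorBasis i₀).ofLp ⬝ᵥ v = 0 := by
      have e1 : ((hA.eigenvectorBasis i₀).ofLp ⬝ᵥ 1) * ((hA.eigenvectorBasis i₀).ofLp ⬝ᵥ v) = 0 := by
        rw [← smul_eq_mul, ← smul_dotProduct, hq, one_dotProduct, hv]
      rcases mul_eq_zero.1 e1 with h | h
      · rw [h, zero_smul] at hq
        have := congrFun hq i₀
        simp at this
      · exact h
    have e2 := specDiag_single_mulVec hA i₀ v
    rw [← hP, hqv, zero_smul, sub_mulVec, one_mulVec, sub_eq_zero] at e2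
    exact e2.symm

end ChebMatrix

end AccVRExtra

/-! ### Deterministic descent of one inexact accelerated primal-dual step. -/

namespace AccVRExtra

section Descent

variable {H : Type*} [NormedAddCommGroup H] [InnerProductSpace ℝ H]

open scoped RealInnerProductSpace

/-- The Bregman distance of a function `F` with gradient map `G`. -/
def bregman (F : H → ℝ) (G : H → H) (u v : H) : ℝ := F u - F v - ⟪G v, u - v⟫

/-- Two-sided quadratic bounds on the Bregman distance imply strong cocoercivity. -/
lemma cocoercive_le_bregman {F : H → ℝ} {G : H → H} {L μ : ℝ} (hL : 0 < L) (hμ : 0 ≤ μ)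
    (hlow : ∀ u v, μ / 2 * ‖u - v‖ ^ 2 ≤ bregman F G u v)
    (hup : ∀ u v, bregman F G u v ≤ L / 2 * ‖u - v‖ ^ 2) (u v : H) :
    μ / 2 * ‖u - v‖ ^ 2 + 1 / (2 * L) * ‖G u - G v - μ • (u - v)‖ ^ 2 ≤ bregman F G u v := by
  set h := G u - G v - μ • (u - v) with hh
  set s := u - v with hs
  -- One step of length 1/L from u along h, compared from above with u and from below with v.
  have h1 := hup (u - (1 / L) • h) u
  have h2 := hlow (u - (1 / L) • h) v
  have e1 : u - (1 / L) • h - u = -((1 / L) • h) := by abel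
  have e2 : u - (1 / L) • h - v = s - (1 / L) • h := by rw [hs]; abel
  unfold bregman at h1 h2 ⊢
  rw [e1, norm_neg, norm_smul, inner_neg_right, inner_smul_right, mul_pow, Real.norm_eq_abs,
    sq_abs] at h1
  rw [e2, norm_sub_sq_real, norm_smul, inner_smul_right, inner_sub_right (G v), inner_smul_right,
    mul_pow, Real.norm_eq_abs, sq_abs] at h2
  have h3 : ‖h‖ ^ 2 = ⟪G u, h⟫ - ⟪G v, h⟫ - μ * ⟪s, h⟫ := by
    rw [← real_inner_self_eq_norm_sq]
    have : ⟪h, h⟫ = ⟪G u - G v - μ • s, h⟫ := by rw [← hh]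
    rw [this, inner_sub_left, inner_sub_left, inner_smul_left]
    simp
  have h4 : 0 ≤ μ / 2 * ((1 / L) ^ 2 * ‖h‖ ^ 2) := by positivity
  have h5 : L / 2 * ((1 / L) ^ 2 * ‖h‖ ^ 2) = 1 / L * ‖h‖ ^ 2 - 1 / (2 * L) * ‖h‖ ^ 2 := by
    field_simp; ring
  have h6 : 1 / L * ‖h‖ ^ 2 = 1 / L * ⟪G u, h⟫ - 1 / L * ⟪G v, h⟫ - μ * (1 / L * ⟪s, h⟫) := by
    rw [h3]; ring
  nlinarith

lemma norm_add_four_sq_le {H : Type*} [SeminormedAddCommGroup H] (a b c d : H) :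
    ‖a + b + c + d‖ ^ 2 ≤ 4 * (‖a‖ ^ 2 + ‖b‖ ^ 2 + ‖c‖ ^ 2 + ‖d‖ ^ 2) := by
  have h : ‖a + b + c + d‖ ≤ ‖a‖ + ‖b‖ + ‖c‖ + ‖d‖ := norm_add₄_le
  have h0 := norm_nonneg (a + b + c + d)
  nlinarith [sq_nonneg (‖a‖ - ‖b‖), sq_nonneg (‖a‖ - ‖c‖), sq_nonneg (‖a‖ - ‖d‖),
    sq_nonneg (‖b‖ - ‖c‖), sq_nonneg (‖b‖ - ‖d‖), sq_nonneg (‖c‖ - ‖d‖)]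

variable {F : H → ℝ} {G : H → H} {L μ θ₁ θ₂ : ℝ}

/-- The primal part of the descent estimate of an accelerated inexact gradient step. -/
lemma primal_descent (hL : 0 < L) (hμ : 0 ≤ μ) (hθ₁ : 0 ≤ θ₁) (hθ : θ₁ + θ₂ ≤ 1)
    (hlow : ∀ u v, μ / 2 * ‖u - v‖ ^ 2 ≤ bregman F G u v)
    (hup : ∀ u v, bregman F G u v ≤ L / 2 * ‖u - v‖ ^ 2)
    {x z w y zn xn g xs : H} (hy : y = θ₁ • z + θ₂ • w + (1 - θ₁ - θ₂) • x)
    (hxn : xn = y + θ₁ • (zn - z)) :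
    bregman F G xn xs ≤ θ₂ * bregman F G w xs + (1 - θ₁ - θ₂) * bregman F G x xs
      + θ₁ * ⟪g - G xs, zn - xs⟫ - θ₁ * ⟪g - G y, z - xs⟫ + 1 / (6 * L) * ‖g - G y‖ ^ 2
      + 2 * L * θ₁ ^ 2 * ‖zn - z‖ ^ 2 - θ₁ * μ / 2 * ‖y - xs‖ ^ 2
      - θ₁ / (2 * L) * ‖G y - G xs - μ • (y - xs)‖ ^ 2 - θ₂ * bregman F G w y := by
  have h1 := hup xn y
  have h2 := cocoercive_le_bregman hL hμ hlow hup xs y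
  have h3 : 0 ≤ bregman F G x y := le_trans (by positivity) (hlow x y)
  rw [show G xs - G y - μ • (xs - y) = -(G y - G xs - μ • (y - xs)) by module, norm_neg,
    norm_sub_rev xs y] at h2
  set h := G y - G xs - μ • (y - xs)
  set e := g - G y with he
  have e1 : xn - y = θ₁ • (zn - z) := by rw [hxn]; abel
  -- zn depends on the noise e, so this product need not have mean zero and is paid by Young's
  -- inequality; the other product, with z - xs, does average out. Together with smoothness the
  -- coefficient of ‖zn - z‖² becomes (3/2 + 1/2) L θ₁².
  have h4 : θ₁ * -⟪e, zn - z⟫ ≤ 1 / (6 * L) * ‖e‖ ^ 2 + 3 / 2 * L * θ₁ ^ 2 * ‖zn - z‖ ^ 2 := by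
    have a1 : -⟪e, zn - z⟫ ≤ ‖e‖ * ‖zn - z‖ := by
      have := abs_real_inner_le_norm e (zn - z)
      have := neg_abs_le ⟪e, zn - z⟫
      linarith
    have a2 : θ₁ * -⟪e, zn - z⟫ ≤ θ₁ * (‖e‖ * ‖zn - z‖) := by gcongr
    have a3 : 1 / (6 * L) * ‖e‖ ^ 2 + 3 / 2 * L * θ₁ ^ 2 * ‖zn - z‖ ^ 2 - θ₁ * (‖e‖ * ‖zn - z‖) =
      1 / (6 * L) * (‖e‖ - 3 * L * θ₁ * ‖zn - z‖) ^ 2 := by field_simp; ring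
    have a4 : 0 ≤ 1 / (6 * L) * (‖e‖ - 3 * L * θ₁ * ‖zn - z‖) ^ 2 := by positivity
    linarith
  have i1 : ⟪G y, xn - y⟫ = θ₁ * ⟪g - G xs, zn - xs⟫ - θ₁ * ⟪e, z - xs⟫ + θ₁ * -⟪e, zn - z⟫
      + θ₁ * ⟪G xs, zn - xs⟫ + θ₁ * ⟪G y, xs - z⟫ := by
    rw [e1, inner_smul_right, he]
    simp only [inner_sub_left, inner_sub_right]
    ring
  have i2 : θ₁ * ⟪G y, xs - z⟫ = θ₁ * ⟪G y, xs - y⟫ + θ₂ * ⟪G y, w - y⟫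
      + (1 - θ₁ - θ₂) * ⟪G y, x - y⟫ := by
    rw [← inner_smul_right, ← inner_smul_right, ← inner_smul_right, ← inner_smul_right,
      ← inner_add_right, ← inner_add_right]
    congr 1
    rw [show θ₁ • (xs - y) + θ₂ • (w - y) + (1 - θ₁ - θ₂) • (x - y) = θ₁ • xs + θ₂ • w +
      (1 - θ₁ - θ₂) • x - y by module]
    nth_rewrite 1 [hy]
    module
  have i3 : ⟪G xs, xn - xs⟫ = θ₁ * ⟪G xs, zn - xs⟫ + θ₂ * ⟪G xs, w - xs⟫
      + (1 - θ₁ - θ₂) * ⟪G xs, x - xs⟫ := by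
    rw [← inner_smul_right, ← inner_smul_right, ← inner_smul_right,
      ← inner_add_right, ← inner_add_right]
    congr 1
    rw [hxn, hy]
    module
  have i4 : ‖xn - y‖ ^ 2 = θ₁ ^ 2 * ‖zn - z‖ ^ 2 := by
    rw [e1, norm_smul, mul_pow, Real.norm_eq_abs, sq_abs]
  have h2' := mul_le_mul_of_nonneg_left h2 hθ₁
  have h3' := mul_nonneg (show 0 ≤ 1 - θ₁ - θ₂ by linarith) h3
  have i5 : θ₁ * (μ / 2 * ‖y - xs‖ ^ 2 + 1 / (2 * L) * ‖h‖ ^ 2) =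
    θ₁ * μ / 2 * ‖y - xs‖ ^ 2 + θ₁ / (2 * L) * ‖h‖ ^ 2 := by ring
  rw [i5] at h2'
  rw [i4] at h1
  unfold bregman at h1 h2' h3' ⊢
  linear_combination h1 + h2' + h3' + h4 + i1 + i2 - i3

variable {M R : H →ₗ[ℝ] H}

/-- The squared norm `‖v‖²_{I - M}`. -/
def compNormSq (M : H →ₗ[ℝ] H) (v : H) : ℝ := ‖v‖ ^ 2 - ⟪M v, v⟫

/-- The z-step uses M z where the multiplier update uses M zn, so `hzn` says that `lamn` + θ₁(I -
M)(zn - z) balances the gradient terms. Polarizing in the metrics R, I - M and the Euclidean one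
gives telescoping squares. The factor 5L is 1/(2α). -/
lemma primal_dual_identity (hL : 0 < L)
    (hMs : ∀ u v, ⟪M u, v⟫ = ⟪u, M v⟫) (hRs : ∀ u v, ⟪R u, v⟫ = ⟪u, R v⟫)
    {z y zn g gs xs lam lamn ν : H} {α : ℝ} (hα : α = 1 / (10 * L)) (hMxs : M xs = 0)
    (hRM : ∀ u v, ⟪M v, R (M u)⟫ = ⟪M v, u⟫) (hRν : ∀ u, ⟪lamn - ν, R (M u)⟫ = ⟪lamn - ν, u⟫)
    (hν : ν = -(α • gs))
    (hlam : lamn = lam + θ₁ • M zn)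
    (hzn : α • g + lam + θ₁ • M z + θ₁ • (zn - z) + (μ * α) • (zn - y) = 0) :
    θ₁ * ⟪g - gs, zn - xs⟫ =
      -(5 * L) * (⟪R (lamn - ν), lamn - ν⟫ - ⟪R (lam - ν), lam - ν⟫
        + θ₁ ^ 2 * ⟪M (zn - xs), zn - xs⟫)
      - 5 * L * θ₁ ^ 2 * (compNormSq M (zn - xs) - compNormSq M (z - xs) + compNormSq M (zn - z))
      - θ₁ * μ / 2 * (‖zn - xs‖ ^ 2 - ‖y - xs‖ ^ 2 + ‖zn - y‖ ^ 2) := by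
  set a := zn - xs with ha
  set c := z - xs with hc
  set u := y - xs with hu
  have hMa : M a = M zn := by rw [ha, map_sub, hMxs, sub_zero]
  have hMc : M c = M z := by rw [hc, map_sub, hMxs, sub_zero]
  have d1 : zn - z = a - c := by rw [ha, hc]; abel
  have d2 : zn - y = a - u := by rw [ha, hu]; abel
  rw [d1, d2, ← hMc] at hzn
  rw [d1, d2]
  set p := lamn - ν with hp
  set r := lam - ν with hr
  have hpr : p = r + θ₁ • M a := by rw [hp, hr, hlam, hMa]; abel
  have hg : α • (g - gs) = -(p + θ₁ • (a - c) - θ₁ • (M a - M c) + (μ * α) • (a - u)) := by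
    rw [hpr, hr, hν, smul_sub, ← sub_eq_zero, ← hzn]
    module
  have j1 : α * ⟪g - gs, a⟫ = -(⟪p, a⟫ + θ₁ * (⟪a, a⟫ - ⟪c, a⟫) - θ₁ * (⟪M a, a⟫ - ⟪M c, a⟫)
      + μ * α * (⟪a, a⟫ - ⟪u, a⟫)) := by
    have := congrArg (fun v => ⟪v, a⟫) hg
    simp only [inner_neg_left, inner_add_left, inner_sub_left, inner_smul_left] at this
    simpa [inner_sub_left] using this
  have j2 : 2 * θ₁ * ⟪p, a⟫ = ⟪R p, p⟫ - ⟪R r, r⟫ + θ₁ ^ 2 * ⟪M a, a⟫ := by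
    have k1 : r = p - θ₁ • M a := by rw [hpr]; abel
    have k2 : ⟪R r, r⟫ = ⟪R p, p⟫ - 2 * θ₁ * ⟪p, R (M a)⟫ + θ₁ ^ 2 * ⟪M a, R (M a)⟫ := by
      rw [k1, map_sub, map_smul]
      simp only [inner_sub_left, inner_sub_right, inner_smul_left, inner_smul_right, hRs]
      rw [← hRs (M a) p, real_inner_comm p (R (M a))]
      simp
      ring
    rw [hRν, hRM] at k2
    linarith
  have j3 : compNormSq M (a - c) = compNormSq M a + compNormSq M c
      - 2 * (⟪c, a⟫ - ⟪M c, a⟫) := by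
    unfold compNormSq
    rw [norm_sub_sq_real, map_sub]
    simp only [inner_sub_left, inner_sub_right]
    rw [hMs a c, real_inner_comm (M c) a, real_inner_comm c a]
    ring
  have j4 : ‖a - u‖ ^ 2 = ‖a‖ ^ 2 + ‖u‖ ^ 2 - 2 * ⟪u, a⟫ := by
    rw [norm_sub_sq_real, real_inner_comm u a]; ring
  have j5 : ⟪a, a⟫ = ‖a‖ ^ 2 := real_inner_self_eq_norm_sq a
  rw [j3, j4]
  have j6 : ⟪g - gs, a⟫ = 10 * L * (α * ⟪g - gs, a⟫) := by rw [hα]; field_simp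
  rw [j6, j1, j5]
  unfold compNormSq
  have hαL : L * α = 1 / 10 := by rw [hα]; field_simp
  linear_combination (-(5 * L)) * j2 - 10 * θ₁ * μ * (‖a‖ ^ 2 - ⟪u, a⟫) * hαL

/-- One step of the accelerated primal-dual method with an inexact gradient `g`. -/
theorem step_descent (hL : 0 < L) (hμ : 0 < μ) (hμL : 3 * μ ≤ L) (hθ₁ : 0 < θ₁)
    (hθ₁' : θ₁ ≤ 1 / 2) (hθ : θ₁ + θ₂ ≤ 1) (hθsq : θ₁ ^ 2 = 3 * μ / (4 * L))
    (hlow : ∀ u v, μ / 2 * ‖u - v‖ ^ 2 ≤ bregman F G u v)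
    (hup : ∀ u v, bregman F G u v ≤ L / 2 * ‖u - v‖ ^ 2)
    (hMs : ∀ u v, ⟪M u, v⟫ = ⟪u, M v⟫) (hRs : ∀ u v, ⟪R u, v⟫ = ⟪u, R v⟫)
    (hM0 : ∀ u, 0 ≤ ⟪M u, u⟫) (hM1 : ∀ u, ⟪M u, u⟫ ≤ 1 / 2 * ‖u‖ ^ 2)
    (hM2 : ∀ u, ‖u - M u‖ ^ 2 ≤ ‖u‖ ^ 2) (hR1 : ∀ u, ⟪R u, u⟫ ≤ 5 / 2 * ‖u‖ ^ 2)
    {x z w y zn xn g xs lam lamn ν : H} {α : ℝ} (hα : α = 1 / (10 * L)) (hMxs : M xs = 0)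
    (hRM : ∀ u v, ⟪M v, R (M u)⟫ = ⟪M v, u⟫) (hRν : ∀ u, ⟪lamn - ν, R (M u)⟫ = ⟪lamn - ν, u⟫)
    (hν : ν = -(α • G xs))
    (hy : y = θ₁ • z + θ₂ • w + (1 - θ₁ - θ₂) • x)
    (hxn : xn = y + θ₁ • (zn - z)) (hlam : lamn = lam + θ₁ • M zn)
    (hzn : α • g + lam + θ₁ • M z + θ₁ • (zn - z) + (μ * α) • (zn - y) = 0) :
    bregman F G xn xs + (1 + θ₁ / 50) * (5 * L * ⟪R (lamn - ν), lamn - ν⟫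
        + 5 * L * θ₁ ^ 2 * compNormSq M (zn - xs)) ≤
      θ₂ * bregman F G w xs + (1 - θ₁ - θ₂) * bregman F G x xs
        + (5 * L * ⟪R (lam - ν), lam - ν⟫ + 5 * L * θ₁ ^ 2 * compNormSq M (z - xs))
        - θ₁ * ⟪g - G y, z - xs⟫ + (1 / (4 * L) * ‖g - G y‖ ^ 2 - θ₂ * bregman F G w y) := by
  have h1 := primal_descent (g := g) (xs := xs) hL hμ.le hθ₁.le hθ hlow hup hy hxn
  have h2 := primal_dual_identity hL hMs hRs hα hMxs hRM hRν hν hlam hzn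
  set h := G y - G xs - μ • (y - xs) with hh
  set e := g - G y with he
  set a := zn - xs with ha
  set d := zn - z with hd
  -- The optimality condition solved for the dual error. The shift by μ(y - xs) inside h makes the
  -- terms in y - xs cancel, so only e, h, d and a remain.
  have h3 : lamn - ν = -(α • e + α • h + θ₁ • (d - M d) + (μ * α) • a) := by
    rw [hlam, hν, ← sub_eq_zero, ← hzn, hh, he, ha, hd, map_sub]
    module
  have h4 : ⟪R (lamn - ν), lamn - ν⟫ ≤
      10 * (α ^ 2 * ‖e‖ ^ 2 + α ^ 2 * ‖h‖ ^ 2 + θ₁ ^ 2 * ‖d‖ ^ 2 + (μ * α) ^ 2 * ‖a‖ ^ 2) := by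
    have k1 := hR1 (lamn - ν)
    have k2 := norm_add_four_sq_le (α • e) (α • h) (θ₁ • (d - M d)) ((μ * α) • a)
    rw [← norm_neg, ← h3] at k2
    simp only [norm_smul, mul_pow, Real.norm_eq_abs, sq_abs] at k2
    have k3 : θ₁ ^ 2 * ‖d - M d‖ ^ 2 ≤ θ₁ ^ 2 * ‖d‖ ^ 2 :=
      mul_le_mul_of_nonneg_left (hM2 d) (sq_nonneg _)
    linarith
  have h5 : 1 / 2 * ‖d‖ ^ 2 ≤ compNormSq M d := by
    have := hM1 d; unfold compNormSq; linarith
  have h6 : compNormSq M a ≤ ‖a‖ ^ 2 := by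
    have := hM0 a; unfold compNormSq; linarith
  have h7 : compNormSq M a + ⟪M a, a⟫ = ‖a‖ ^ 2 := by unfold compNormSq; ring
  set Λn := ⟪R (lamn - ν), lamn - ν⟫
  set Λ := ⟪R (lam - ν), lam - ν⟫
  set E := ‖e‖ ^ 2 with hE
  set Hh := ‖h‖ ^ 2 with hHh
  set D := ‖d‖ ^ 2 with hD
  set A := ‖a‖ ^ 2 with hA
  have hE0 : 0 ≤ E := sq_nonneg _
  have hH0 : 0 ≤ Hh := sq_nonneg _
  have hD0 : 0 ≤ D := sq_nonneg _
  have hA0 : 0 ≤ A := sq_nonneg _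
  -- Budget for the extra θ₁/50. The h term is available from cocoercivity. The d term has 5/2 - 2 =
  -- 1/2 of Lθ₁² left, which fixes 1/50 given θ₁ ≤ 1/2. The a term takes half of θ₁μ/2, the other
  -- half going to `m2`. The e term raises 1/6 to 1/4.
  have m1 : θ₁ / 50 * (5 * L * Λn) ≤
      1 / (12 * L) * E + θ₁ / (2 * L) * Hh + 1 / 2 * L * θ₁ ^ 2 * D + θ₁ * μ / 4 * A := by
    have n1 : θ₁ / 50 * (5 * L * Λn) ≤ θ₁ / 50 * (5 * L * (10 * (α ^ 2 * E + α ^ 2 * Hh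
      + θ₁ ^ 2 * D + (μ * α) ^ 2 * A))) := by gcongr
    have n2 : θ₁ / 50 * (5 * L * (10 * (α ^ 2 * E + α ^ 2 * Hh + θ₁ ^ 2 * D + (μ * α) ^ 2 * A)))
      = θ₁ / (100 * L) * E + θ₁ / (100 * L) * Hh + θ₁ * (L * θ₁ ^ 2 * D)
        + θ₁ * μ * (μ / L) / 100 * A := by rw [hα]; field_simp; ring
    have n3 : θ₁ / (100 * L) * E ≤ 1 / (12 * L) * E := by
      refine mul_le_mul_of_nonneg_right ?_ hE0
      rw [div_le_div_iff₀ (by positivity) (by positivity)]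
      nlinarith
    have n4 : θ₁ / (100 * L) * Hh ≤ θ₁ / (2 * L) * Hh := by gcongr; norm_num
    have n5 : θ₁ * (L * θ₁ ^ 2 * D) ≤ 1 / 2 * (L * θ₁ ^ 2 * D) := by gcongr
    have n6 : θ₁ * μ * (μ / L) / 100 * A ≤ θ₁ * μ / 4 * A := by
      have : μ / L ≤ 1 := by rw [div_le_one hL]; linarith
      have : θ₁ * μ * (μ / L) ≤ θ₁ * μ * 1 := by gcongr
      have : 0 < θ₁ * μ := by positivity
      refine mul_le_mul_of_nonneg_right ?_ hA0
      linarith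
    linarith
  have m2 : θ₁ / 50 * (5 * L * θ₁ ^ 2 * compNormSq M a) ≤ θ₁ * μ / 4 * A := by
    have n1 : θ₁ / 50 * (5 * L * θ₁ ^ 2 * compNormSq M a) = 3 / 40 * (θ₁ * μ * compNormSq M a) := by
      rw [hθsq]; field_simp; ring
    have n2 : θ₁ * μ * compNormSq M a ≤ θ₁ * μ * A := by gcongr
    have n3 : 0 ≤ θ₁ * μ * A := by positivity
    linarith
  have m3 : 5 * L * θ₁ ^ 2 * (1 / 2 * D) ≤ 5 * L * θ₁ ^ 2 * compNormSq M d := by gcongr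
  have m4 : 0 ≤ θ₁ * μ / 2 * ‖zn - y‖ ^ 2 := by positivity
  have m5 : 0 ≤ 5 * L * θ₁ ^ 2 * ⟪M a, a⟫ := by have := hM0 a; positivity
  have m6 : 1 / (4 * L) * E = 1 / (6 * L) * E + 1 / (12 * L) * E := by field_simp; ring
  rw [m6]
  linarith

/-- Combination of the descent estimate with the refresh of the snapshot: `fx, fw` and `fx', fw'`
are the Bregman distances of the iterate and of the snapshot before and after the step. -/
lemma lyapunov_combine {q B fx fw fx' fw' Q Q' N : ℝ} (hθ₁ : 0 < θ₁) (hθ₁' : θ₁ ≤ 1 / 2)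
    (hθ₂ : 0 ≤ θ₂) (hθ : θ₁ + θ₂ ≤ 1) (hq : 2 / 3 * θ₁ ≤ q) (hq' : 2 / 3 * θ₂ ≤ q)
    (hB : B = θ₂ / (q - θ₁ / 6)) (hfx : 0 ≤ fx) (hfw : 0 ≤ fw)
    (h : fx' + (1 + θ₁ / 50) * Q' ≤ θ₂ * fw + (1 - θ₁ - θ₂) * fx + Q + N) :
    (1 - B * q) * fx' + B * fw' + (1 + θ₁ / 50) * Q' ≤
      (1 + θ₁ / 50)⁻¹ * ((1 - B * q) * fx + B * fw + (1 + θ₁ / 50) * Q)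
        + B * (fw' - q * fx' - (1 - q) * fw) + N := by
  -- B solves θ₂ + B(1 - q) = B(1 - θ₁/6), so the snapshot term shrinks by 1 - θ₁/6. Since q - θ₁/6
  -- ≥ 3q/4, B ≤ 2, which keeps the loss for x below θ₁/3.
  have hd : 0 < q - θ₁ / 6 := by linarith
  have hBd : B * (q - θ₁ / 6) = θ₂ := by rw [hB, div_mul_cancel₀ _ hd.ne']
  have hB0 : 0 ≤ B := by rw [hB]; positivity
  have hBq : B * q ≤ θ₂ + θ₁ / 3 := by
    have : B ≤ 2 := by
      rw [hB, div_le_iff₀ hd]; linarith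
    nlinarith
  set r := (1 + θ₁ / 50)⁻¹ with hr
  have hr1 : r * (1 + θ₁ / 50) = 1 := inv_mul_cancel₀ (by positivity)
  have hrl : 1 - θ₁ / 50 ≤ r := by
    rw [hr, ← one_div, le_div_iff₀ (by positivity)]; nlinarith
  have hr0 : 0 < r := by positivity
  have h1 : B * (1 - θ₁ / 6) * fw ≤ B * r * fw := by
    gcongr; linarith
  have h2 : (1 - θ₁ - θ₂) * fx ≤ r * (1 - B * q) * fx := by
    gcongr
    have : (1 - θ₁ / 50) * (1 - B * q) ≤ r * (1 - B * q) := by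
      gcongr; linarith
    nlinarith [mul_nonneg hB0 (by linarith : 0 ≤ q)]
  have h3 : r * ((1 - B * q) * fx + B * fw + (1 + θ₁ / 50) * Q) =
    r * (1 - B * q) * fx + B * r * fw + Q := by
    linear_combination Q * hr1
  rw [h3]
  linear_combination h + h1 + h2 - fw * hBd

end Descent

end AccVRExtra

/-! ### Smooth and strongly convex functions in terms of Bregman distances. -/

namespace AccVRExtra

open scoped RealInnerProductSpace Topology

section Functions

variable {p : ℕ}

local notation "E" => EuclideanSpace ℝ (Fin p)

lemma hasDerivAt_line {g : E → ℝ} (hg : Differentiable ℝ g) (v s : E) (t : ℝ) :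
    HasDerivAt (fun t : ℝ => g (v + t • s)) ⟪gradient g (v + t • s), s⟫ t := by
  have h1 : HasDerivAt (fun t : ℝ => v + t • s) s t := by
    simpa using ((hasDerivAt_id t).smul_const s).const_add v
  have h2 := (hg (v + t • s)).hasGradientAt.hasFDerivAt
  exact h2.comp_hasDerivAt t h1

lemma IsSmoothWith.bregman_le {g : E → ℝ} {L : ℝ} (hg : IsSmoothWith L g) (u v : E) :
    bregman g (gradient g) u v ≤ L / 2 * ‖u - v‖ ^ 2 := by
  set s := u - v with hs
  set φ : ℝ → ℝ := fun t => g (v + t • s) - t * ⟪gradient g v, s⟫ - L / 2 * ‖s‖ ^ 2 * t ^ 2 with hφ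
  have hd : ∀ t, HasDerivAt φ
      (⟪gradient g (v + t • s), s⟫ - ⟪gradient g v, s⟫ - L / 2 * ‖s‖ ^ 2 * (2 * t)) t := by
    intro t
    have h1 := hasDerivAt_line hg.1 v s t
    have h2 : HasDerivAt (fun t : ℝ => t * ⟪gradient g v, s⟫) ⟪gradient g v, s⟫ t := by
      simpa using (hasDerivAt_id t).mul_const ⟪gradient g v, s⟫
    have h3 : HasDerivAt (fun t : ℝ => L / 2 * ‖s‖ ^ 2 * t ^ 2) (L / 2 * ‖s‖ ^ 2 * (2 * t)) t := by
      simpa using (hasDerivAt_pow 2 t).const_mul (L / 2 * ‖s‖ ^ 2)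
    exact (h1.sub h2).sub h3
  have hanti : AntitoneOn φ (Set.Icc 0 1) := by
    apply antitoneOn_of_deriv_nonpos (convex_Icc 0 1)
    · exact fun t _ => (hd t).continuousAt.continuousWithinAt
    · exact fun t _ => (hd t).differentiableAt.differentiableWithinAt
    · intro t ht
      rw [interior_Icc] at ht
      rw [(hd t).deriv, ← inner_sub_left]
      have h1 := real_inner_le_norm (gradient g (v + t • s) - gradient g v) s
      have h2 := hg.2 v (v + t • s)
      rw [add_sub_cancel_left, norm_smul, Real.norm_eq_abs, abs_of_pos ht.1] at h2
      have h3 := mul_le_mul_of_nonneg_right h2 (norm_nonneg s)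
      nlinarith
  have h01 := hanti (Set.left_mem_Icc.2 zero_le_one) (Set.right_mem_Icc.2 zero_le_one) zero_le_one
  simp only [hφ] at h01
  rw [one_smul, zero_smul, add_zero, hs, add_sub_cancel, ← hs] at h01
  unfold bregman
  linarith

lemma le_bregman_of_strongConvexOn {g : E → ℝ} {μ : ℝ} (hd : Differentiable ℝ g)
    (hg : StrongConvexOn Set.univ μ g) (u v : E) :
    μ / 2 * ‖u - v‖ ^ 2 ≤ bregman g (gradient g) u v := by
  set s := u - v with hs
  have h0 := (hasDerivAt_line hd v s 0).tendsto_slope_zero_right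
  simp only [zero_smul, add_zero, zero_add, smul_eq_mul] at h0
  have h1 : Filter.Tendsto (fun t : ℝ => g u - g v - (1 - t) * (μ / 2 * ‖s‖ ^ 2)) (𝓝[>] 0)
      (𝓝 (g u - g v - (1 - 0) * (μ / 2 * ‖s‖ ^ 2))) := by
    apply Filter.Tendsto.mono_left _ nhdsWithin_le_nhds
    exact Continuous.tendsto (by fun_prop) 0
  have h2 := le_of_tendsto_of_tendsto h0 h1 ?_
  · unfold bregman
    rw [← hs]
    linarith
  · have : Set.Ioo (0 : ℝ) 1 ∈ 𝓝[>] (0 : ℝ) := Ioo_mem_nhdsGT zero_lt_one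
    filter_upwards [this] with t ht
    have h3 := hg.2 (Set.mem_univ u) (Set.mem_univ v) ht.1.le (sub_nonneg.2 ht.2.le) (by ring)
    have h4 : t • u + (1 - t) • v = v + t • s := by rw [hs]; module
    rw [h4, ← hs] at h3
    simp only [smul_eq_mul] at h3
    rw [inv_mul_le_iff₀ ht.1]
    nlinarith

lemma IsSmoothWith.nonneg {g : E → ℝ} {L : ℝ} (hp : 1 ≤ p) (hg : IsSmoothWith L g) : 0 ≤ L := by
  have : Nonempty (Fin p) := ⟨⟨0, hp⟩⟩
  obtain ⟨v, hv⟩ := exists_ne (0 : E)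
  have h := (norm_nonneg _).trans (hg.2 0 v)
  rw [sub_zero] at h
  exact nonneg_of_mul_nonneg_left h (norm_pos_iff.2 hv)

lemma le_of_strongConvexOn_of_isSmoothWith {g : E → ℝ} {L μ : ℝ} (hp : 1 ≤ p)
    (hg : IsSmoothWith L g) (hs : StrongConvexOn Set.univ μ g) : μ ≤ L := by
  have : Nonempty (Fin p) := ⟨⟨0, hp⟩⟩
  obtain ⟨v, hv⟩ := exists_ne (0 : E)
  have h := (le_bregman_of_strongConvexOn hg.1 hs v 0).trans (hg.bregman_le v 0)
  rw [sub_zero] at h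
  have : 0 < ‖v‖ ^ 2 := by have := norm_pos_iff.2 hv; positivity
  have := le_of_mul_le_mul_right h this
  linarith

lemma hasGradientAt_fun_sum {ι : Type*} (s : Finset ι) {g : ι → E → ℝ} {g' : ι → E} {x : E}
    (h : ∀ i ∈ s, HasGradientAt (g i) (g' i) x) :
    HasGradientAt (fun y => ∑ i ∈ s, g i y) (∑ i ∈ s, g' i) x := by
  rw [hasGradientAt_iff_hasFDerivAt, map_sum]
  exact HasFDerivAt.fun_sum fun i hi => (h i hi).hasFDerivAt

lemma hasGradientAt_const_mul {g : E → ℝ} {g' x : E} (h : HasGradientAt g g' x) (c : ℝ) :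
    HasGradientAt (fun y => c * g y) (c • g') x := by
  rw [hasGradientAt_iff_hasFDerivAt, map_smul]
  exact h.hasFDerivAt.const_mul c

end Functions

namespace Problem

variable {p m n : ℕ} {P : Problem p m n}

lemma gradient_loc (hf : P.FunctionAssumptions) (i : Fin m) (x : EuclideanSpace ℝ (Fin p)) :
    gradient (P.loc i) x = (1 / (n : ℝ)) • ∑ j, gradient (P.f i j) x :=
  (hasGradientAt_const_mul (hasGradientAt_fun_sum Finset.univ fun j _ =>
    ((hf.comp_smooth i j).1 x).hasGradientAt) _).gradient

lemma bregman_loc (hf : P.FunctionAssumptions) (i : Fin m) (u v : EuclideanSpace ℝ (Fin p)) :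
    bregman (P.loc i) (gradient (P.loc i)) u v =
      (1 / (n : ℝ)) * ∑ j, bregman (P.f i j) (gradient (P.f i j)) u v := by
  simp only [bregman, gradient_loc hf, loc, Finset.sum_sub_distrib, mul_sub, inner_smul_left,
    sum_inner]
  simp

/-- Each component gradient difference is controlled by the Bregman distance. -/
lemma norm_gradient_sub_sq_le (hp : 1 ≤ p) (hf : P.FunctionAssumptions) (i : Fin m) (j : Fin n)
    (u v : EuclideanSpace ℝ (Fin p)) :
    ‖gradient (P.f i j) u - gradient (P.f i j) v‖ ^ 2 ≤
      2 * P.Lc i j * bregman (P.f i j) (gradient (P.f i j)) u v := by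
  have hs := hf.comp_smooth i j
  rcases (hs.nonneg hp).eq_or_lt with h0 | h0
  · have := hs.2 v u
    rw [← h0, zero_mul] at this
    rw [le_antisymm this (norm_nonneg _), ← h0]
    simp
  · have h1 := cocoercive_le_bregman (F := P.f i j) (G := gradient (P.f i j)) (μ := 0) h0 le_rfl
      (le_bregman_of_strongConvexOn hs.1 (strongConvexOn_zero.2 (hf.comp_convex i j)))
      hs.bregman_le u v
    simp only [zero_div, zero_mul, zero_smul, sub_zero, zero_add] at h1
    rw [one_div, inv_mul_le_iff₀ (by positivity)] at h1
    exact h1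

lemma sum_gradient_loc_eq_zero (hf : P.FunctionAssumptions) {xs : EuclideanSpace ℝ (Fin p)}
    (hx : ∀ x, ∑ i, P.loc i xs ≤ ∑ i, P.loc i x) : ∑ i, gradient (P.loc i) xs = 0 := by
  have h1 := hasGradientAt_fun_sum Finset.univ
    fun i (_ : i ∈ Finset.univ) => ((hf.loc_smooth i).1 xs).hasGradientAt
  have h2 : IsLocalMin (fun y => ∑ i, P.loc i y) xs := Filter.Eventually.of_forall hx
  have h3 := h2.hasFDerivAt_eq_zero h1.hasFDerivAt
  exact (InnerProductSpace.toDual ℝ _).map_eq_zero_iff.1 h3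

end Problem

end AccVRExtra

/-! ### Mini-batches: mean and variance. -/

namespace AccVRExtra

open scoped RealInnerProductSpace
open MeasureTheory

section Sampling

variable {n b p : ℕ}

/-- The mean of a mini-batch is unbiased. -/
lemma integral_miniBatch (ν : Measure (Fin n)) [IsProbabilityMeasure ν] (hb : 0 < b)
    (v : Fin n → EuclideanSpace ℝ (Fin p)) :
    ∫ S, (1 / (b : ℝ)) • ∑ l : Fin b, v (S l) ∂(Measure.pi fun _ : Fin b => ν) = ∫ j, v j ∂ν := by
  rw [integral_smul, integral_finsetSum _ fun _ _ => Integrable.of_finite]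
  have : ∀ l : Fin b, ∫ S, v (S l) ∂(Measure.pi fun _ : Fin b => ν) = ∫ j, v j ∂ν := fun l =>
    integral_comp_eval (μ := fun _ : Fin b => ν) (i := l) (f := v) (by fun_prop)
  simp only [this, Finset.sum_const, Finset.card_univ, Fintype.card_fin]
  rw [← Nat.cast_smul_eq_nsmul ℝ, smul_smul, one_div, inv_mul_cancel₀ (by positivity), one_smul]

lemma integral_miniBatch_sub_sq_le (ν : Measure (Fin n)) [IsProbabilityMeasure ν] (hb : 0 < b)
    (v : Fin n → ℝ) :
    ∫ S, ((1 / (b : ℝ)) * ∑ l : Fin b, v (S l) - ∫ j, v j ∂ν) ^ 2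
      ∂(Measure.pi fun _ : Fin b => ν) ≤ 1 / b * ∫ j, v j ^ 2 ∂ν := by
  have h1 := ProbabilityTheory.variance_sum_pi (μ := fun _ : Fin b => ν) (X := fun _ => v)
    (fun _ => MemLp.of_discrete)
  have h2 : ProbabilityTheory.variance v ν ≤ ∫ j, v j ^ 2 ∂ν :=
    ProbabilityTheory.variance_le_expectation_sq (by fun_prop)
  have h3 : ∫ S, (∑ l : Fin b, fun S : Fin b → Fin n => v (S l)) S
      ∂(Measure.pi fun _ : Fin b => ν) = b * ∫ j, v j ∂ν := by
    simp only [Finset.sum_apply]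
    rw [integral_finsetSum _ fun _ _ => Integrable.of_finite]
    have : ∀ l : Fin b, ∫ S, v (S l) ∂(Measure.pi fun _ : Fin b => ν) = ∫ j, v j ∂ν := fun l =>
      integral_comp_eval (μ := fun _ : Fin b => ν) (i := l) (f := v) (by fun_prop)
    simp [this]
  rw [ProbabilityTheory.variance_eq_integral (by fun_prop), h3] at h1
  simp only [Finset.sum_apply, Finset.sum_const, Finset.card_univ, Fintype.card_fin,
    nsmul_eq_mul] at h1
  have hb' : (b : ℝ) ≠ 0 := by positivity
  have h4 : ∀ S : Fin b → Fin n, ((1 / (b : ℝ)) * ∑ l : Fin b, v (S l) - ∫ j, v j ∂ν) ^ 2 =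
      (1 / (b : ℝ)) ^ 2 * (∑ l : Fin b, v (S l) - b * ∫ j, v j ∂ν) ^ 2 := by
    intro S; field_simp
  simp only [h4]
  rw [integral_const_mul, h1]
  calc (1 / (b : ℝ)) ^ 2 * (b * ProbabilityTheory.variance v ν)
      = 1 / b * ProbabilityTheory.variance v ν := by field_simp
    _ ≤ _ := by gcongr

/-- The variance of a mini-batch is at most the second moment divided by the batch size. -/
lemma integral_norm_miniBatch_sub_sq_le (ν : Measure (Fin n)) [IsProbabilityMeasure ν]
    (hb : 0 < b) (v : Fin n → EuclideanSpace ℝ (Fin p)) :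
    ∫ S, ‖(1 / (b : ℝ)) • ∑ l : Fin b, v (S l) - ∫ j, v j ∂ν‖ ^ 2
      ∂(Measure.pi fun _ : Fin b => ν) ≤ 1 / b * ∫ j, ‖v j‖ ^ 2 ∂ν := by
  have hc : ∀ c : Fin p, (∫ j, v j ∂ν) c = ∫ j, v j c ∂ν := fun c =>
    ((EuclideanSpace.proj (𝕜 := ℝ) c).integral_comp_comm (φ := v) Integrable.of_finite).symm
  simp only [EuclideanSpace.real_norm_sq_eq]
  rw [integral_finsetSum _ fun _ _ => Integrable.of_finite,
    integral_finsetSum _ fun _ _ => Integrable.of_finite, Finset.mul_sum]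
  refine Finset.sum_le_sum fun c _ => ?_
  have := integral_miniBatch_sub_sq_le ν hb fun j => v j c
  simpa [hc] using this

end Sampling

/-! ### The laws of the random choices, conditioning on the past, and the two costs. -/

namespace Problem

variable {p m n : ℕ} (P : Problem p m n)

lemma integral_sampleLaw {E : Type*} [NormedAddCommGroup E] [NormedSpace ℝ E] [CompleteSpace E]
    {i : Fin m} (h0 : ∀ j, 0 ≤ P.prob i j) (g : Fin n → E) :
    ∫ j, g j ∂(P.sampleLaw i) = ∑ j, P.prob i j • g j := by
  rw [sampleLaw, integral_finsetSum_measure]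
  · refine Finset.sum_congr rfl fun j _ => ?_
    rw [integral_smul_measure, integral_dirac, ENNReal.toReal_ofReal (h0 j)]
  · intro j _
    have : IsFiniteMeasure (ENNReal.ofReal (P.prob i j) • Measure.dirac j) :=
      Measure.smul_finite _ ENNReal.ofReal_ne_top
    exact Integrable.of_finite

lemma isProbabilityMeasure_sampleLaw {i : Fin m} (h0 : ∀ j, 0 ≤ P.prob i j)
    (h1 : ∑ j, P.prob i j = 1) : IsProbabilityMeasure (P.sampleLaw i) := by
  constructor
  rw [sampleLaw, Measure.finsetSum_apply]
  simp only [Measure.smul_apply, measure_univ, smul_eq_mul, mul_one]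
  rw [← ENNReal.ofReal_sum_of_nonneg fun j _ => h0 j, h1, ENNReal.ofReal_one]

lemma integral_coinLaw (hb : P.b ≤ n) (g : Bool → ℝ) :
    ∫ c, g c ∂P.coinLaw = (P.b : ℝ) / n * g true + (1 - (P.b : ℝ) / n) * g false := by
  have h1 : (P.b : ℝ) / n ≤ 1 := div_le_one_of_le₀ (by exact_mod_cast hb) (by positivity)
  have i1 : IsFiniteMeasure (ENNReal.ofReal ((P.b : ℝ) / n) • Measure.dirac true) :=
      Measure.smul_finite _ ENNReal.ofReal_ne_top
  have i2 : IsFiniteMeasure (ENNReal.ofReal (1 - (P.b : ℝ) / n) • Measure.dirac false) :=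
      Measure.smul_finite _ ENNReal.ofReal_ne_top
  rw [coinLaw, integral_add_measure Integrable.of_finite Integrable.of_finite,
    integral_smul_measure, integral_smul_measure, integral_dirac, integral_dirac,
    ENNReal.toReal_ofReal (by positivity), ENNReal.toReal_ofReal (by linarith)]
  rfl

lemma isProbabilityMeasure_coinLaw (hb : P.b ≤ n) : IsProbabilityMeasure P.coinLaw := by
  have h1 : (P.b : ℝ) / n ≤ 1 := div_le_one_of_le₀ (by exact_mod_cast hb) (by positivity)
  constructor
  rw [coinLaw]
  simp only [Measure.add_apply, Measure.smul_apply, measure_univ, smul_eq_mul, mul_one]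
  rw [← ENNReal.ofReal_add (by positivity) (by linarith), add_sub_cancel, ENNReal.ofReal_one]

lemma isProbabilityMeasure_drawLaw (hb : P.b ≤ n)
    (hs : ∀ i, IsProbabilityMeasure (P.sampleLaw i)) : IsProbabilityMeasure P.drawLaw := by
  have := P.isProbabilityMeasure_coinLaw hb
  unfold drawLaw; infer_instance

/-- Expectation of a quantity that depends on the choices of one node only. -/
lemma integral_drawLaw_eval (hb : P.b ≤ n) (hs : ∀ i, IsProbabilityMeasure (P.sampleLaw i))
    (i : Fin m) (g : (Fin P.b → Fin n) → Bool → ℝ) :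
    ∫ d, g (d i).1 (d i).2 ∂P.drawLaw =
      ∫ S, ((P.b : ℝ) / n * g S true + (1 - (P.b : ℝ) / n) * g S false)
        ∂(Measure.pi fun _ : Fin P.b => P.sampleLaw i) := by
  have := P.isProbabilityMeasure_coinLaw hb
  have h := integral_comp_eval
    (μ := fun i => (Measure.pi fun _ : Fin P.b => P.sampleLaw i).prod P.coinLaw) (i := i)
    (f := fun d : (Fin P.b → Fin n) × Bool => g d.1 d.2) (by fun_prop)
  refine h.trans ?_
  rw [integral_prod _ Integrable.of_finite]
  simp only [P.integral_coinLaw hb]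

lemma integral_drawLaw_samples (hb : P.b ≤ n) (hs : ∀ i, IsProbabilityMeasure (P.sampleLaw i))
    (i : Fin m) (g : (Fin P.b → Fin n) → ℝ) :
    ∫ d, g (d i).1 ∂P.drawLaw = ∫ S, g S ∂(Measure.pi fun _ : Fin P.b => P.sampleLaw i) := by
  rw [P.integral_drawLaw_eval hb hs i fun S _ => g S]
  congr 1
  ext S
  ring

lemma isProbabilityMeasure_historyLaw (hb : P.b ≤ n)
    (hs : ∀ i, IsProbabilityMeasure (P.sampleLaw i)) (k : ℕ) :
    IsProbabilityMeasure (P.historyLaw k) := by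
  have := P.isProbabilityMeasure_drawLaw hb hs
  unfold historyLaw; infer_instance

/-- Conditioning on the first `k` iterations. -/
lemma expect_succ (hb : P.b ≤ n) (hs : ∀ i, IsProbabilityMeasure (P.sampleLaw i))
    (x₀ : Stack m p) (k : ℕ) (g : State m p → ℝ) :
    P.expect x₀ (k + 1) g = P.expect x₀ k fun s => ∫ d, g (P.step d s) ∂P.drawLaw := by
  have := P.isProbabilityMeasure_drawLaw hb hs
  have := P.isProbabilityMeasure_historyLaw hb hs k
  have h := (measurePreserving_piFinSuccAbove (fun _ : Fin (k + 1) => P.drawLaw) (Fin.last k))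
  have h2 := h.integral_comp' (fun q : P.Draw × (Fin k → P.Draw) => g (P.step q.1 (P.run x₀ k q.2)))
  have h3 : P.expect x₀ (k + 1) g = ∫ q, g (P.step q.1 (P.run x₀ k q.2))
      ∂(P.drawLaw.prod (P.historyLaw k)) := by
    refine Eq.trans ?_ h2
    unfold expect historyLaw
    congr 1
    ext ω
    simp [run, MeasurableEquiv.piFinSuccAbove_apply, Fin.insertNthEquiv]
    rfl
  rw [h3, integral_prod_symm _ Integrable.of_finite]
  rfl

lemma expect_zero (x₀ : Stack m p) (g : State m p → ℝ) :
    P.expect x₀ 0 g = g (init (n := n) x₀) := by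
  unfold expect historyLaw
  rw [Measure.pi_of_empty _ Fin.elim0, integral_dirac]
  rfl

lemma expect_mono (hb : P.b ≤ n) (hs : ∀ i, IsProbabilityMeasure (P.sampleLaw i))
    (x₀ : Stack m p) (k : ℕ) {g h : State m p → ℝ}
    (hgh : ∀ ω, g (P.run x₀ k ω) ≤ h (P.run x₀ k ω)) : P.expect x₀ k g ≤ P.expect x₀ k h := by
  have := P.isProbabilityMeasure_historyLaw hb hs k
  exact integral_mono Integrable.of_finite Integrable.of_finite hgh

lemma expect_const_mul (x₀ : Stack m p) (k : ℕ) (g : State m p → ℝ) (c : ℝ) :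
    P.expect x₀ k (fun s => c * g s) = c * P.expect x₀ k g := integral_const_mul _ _

/-- Expected number of component gradient evaluations of a node. -/
lemma expect_evals (hn : 1 ≤ n) (hb : P.b ≤ n) (hs : ∀ i, IsProbabilityMeasure (P.sampleLaw i))
    (x₀ : Stack m p) (k : ℕ) (i : Fin m) :
    P.expect x₀ k (fun s => (s.evals i : ℝ)) = n + 3 * P.b * k := by
  induction k with
  | zero => rw [expect_zero]; simp [init]
  | succ k ih =>
    have := P.isProbabilityMeasure_drawLaw hb hs
    have := P.isProbabilityMeasure_historyLaw hb hs k
    -- A refresh costs n with probability b/n, so b on average, on top of 2b.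
    have hst : ∀ s : State m p, ∫ d, ((P.step d s).evals i : ℝ) ∂P.drawLaw =
        s.evals i + 3 * P.b := by
      intro s
      have h := P.integral_drawLaw_eval hb hs i
        fun _ c => ((s.evals i + 2 * P.b + (if c = true then n else 0) : ℕ) : ℝ)
      refine h.trans ?_
      have hn' : (n : ℝ) ≠ 0 := by positivity
      simp
      field_simp
      ring
    rw [P.expect_succ hb hs]
    simp only [hst]
    have h2 : P.expect x₀ k (fun s => (s.evals i : ℝ) + 3 * P.b) =
        P.expect x₀ k (fun s => (s.evals i : ℝ)) + 3 * P.b := by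
      unfold expect
      rw [integral_add Integrable.of_finite Integrable.of_finite]
      simp
    rw [h2, ih]
    push_cast; ring

lemma rounds_run (x₀ : Stack m p) (k : ℕ) (ω : Fin k → P.Draw) :
    (P.run x₀ k ω).rounds = k * (2 * chebDeg P.W) := by
  induction k with
  | zero => simp [run, init]
  | succ k ih =>
    change (P.run x₀ k _).rounds + 2 * chebDeg P.W = _
    rw [ih]; ring

end Problem

end AccVRExtra

/-! ### Stacked variables, the stacked objective, and the error of the gradient estimator. -/

namespace AccVRExtra

open scoped RealInnerProductSpace
open MeasureTheory

section Stacks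

variable {m p : ℕ}

/-- Stacked variables with the Euclidean norm. -/
abbrev StackSpace (m p : ℕ) : Type := PiLp 2 fun _ : Fin m => EuclideanSpace ℝ (Fin p)

/-- The action of a matrix on stacked variables as a linear map. -/
def actLin (M : Matrix (Fin m) (Fin m) ℝ) : StackSpace m p →ₗ[ℝ] StackSpace m p where
  toFun u := WithLp.toLp 2 (act M u.ofLp)
  map_add' u v := by
    ext1 i
    simp [act, Finset.sum_add_distrib]
  map_smul' c u := by
    ext1 i
    simp only [act, Finset.smul_sum, RingHom.id_apply,
      PiLp.smul_apply]
    exact Finset.sum_congr rfl fun j _ => smul_comm _ _ _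

lemma actLin_apply (M : Matrix (Fin m) (Fin m) ℝ) (u : StackSpace m p) (i : Fin m) :
    actLin M u i = ∑ j, M i j • u j := rfl

lemma actLin_apply_apply (M : Matrix (Fin m) (Fin m) ℝ) (u : StackSpace m p) (i : Fin m)
    (c : Fin p) : actLin M u i c = M.mulVec (fun j => u j c) i := by
  simp [actLin_apply, Matrix.mulVec, dotProduct]

lemma actLin_mul (M N : Matrix (Fin m) (Fin m) ℝ) (u : StackSpace m p) :
    actLin (M * N) u = actLin M (actLin N u) := by
  ext i c
  simp only [actLin_apply_apply, ← Matrix.mulVec_mulVec]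

lemma actLin_one (u : StackSpace m p) : actLin 1 u = u := by
  ext i c
  simp [actLin_apply_apply]

lemma actLin_sub (M N : Matrix (Fin m) (Fin m) ℝ) (u : StackSpace m p) :
    actLin (M - N) u = actLin M u - actLin N u := by
  ext i c
  simp [actLin_apply_apply, Matrix.sub_mulVec]

lemma actLin_smul (a : ℝ) (M : Matrix (Fin m) (Fin m) ℝ) (u : StackSpace m p) :
    actLin (a • M) u = a • actLin M u := by
  ext i c
  simp [actLin_apply_apply, Matrix.smul_mulVec]

lemma inner_actLin (M : Matrix (Fin m) (Fin m) ℝ) (u v : StackSpace m p) :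
    ⟪actLin M u, v⟫ = ∑ c, M.mulVec (fun j => u j c) ⬝ᵥ fun j => v j c := by
  simp only [PiLp.inner_apply, dotProduct]
  rw [Finset.sum_comm]
  refine Finset.sum_congr rfl fun c _ => Finset.sum_congr rfl fun i _ => ?_
  rw [← actLin_apply_apply]
  simp [mul_comm]

lemma inner_actLin_comm {M : Matrix (Fin m) (Fin m) ℝ} (hM : M.IsHermitian)
    (u v : StackSpace m p) : ⟪actLin M u, v⟫ = ⟪u, actLin M v⟫ := by
  rw [real_inner_comm _ u, inner_actLin, inner_actLin]
  refine Finset.sum_congr rfl fun c _ => ?_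
  have : M.transpose = M := by rwa [← Matrix.conjTranspose_eq_transpose_of_trivial]
  rw [dotProduct_comm, Matrix.dotProduct_mulVec, ← Matrix.mulVec_transpose, this]

lemma inner_actLin_nonneg {M : Matrix (Fin m) (Fin m) ℝ} (hM : M.PosSemidef)
    (u : StackSpace m p) : 0 ≤ ⟪actLin M u, u⟫ := by
  rw [inner_actLin]
  refine Finset.sum_nonneg fun c _ => ?_
  have := hM.dotProduct_mulVec_nonneg fun j => u j c
  rw [dotProduct_comm]
  simpa using this

lemma inner_actLin_le {M : Matrix (Fin m) (Fin m) ℝ} {a : ℝ} (hM : (a • 1 - M).PosSemidef)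
    (u : StackSpace m p) : ⟪actLin M u, u⟫ ≤ a * ‖u‖ ^ 2 := by
  have := inner_actLin_nonneg hM u
  rw [actLin_sub, actLin_smul, actLin_one, inner_sub_left, inner_smul_left,
    real_inner_self_eq_norm_sq] at this
  simpa using this

lemma norm_sub_actLin_sq_le {M : Matrix (Fin m) (Fin m) ℝ} (hM : M.IsHermitian)
    (hM2 : ((2 : ℝ) • M - M * M).PosSemidef) (u : StackSpace m p) :
    ‖u - actLin M u‖ ^ 2 ≤ ‖u‖ ^ 2 := by
  have := inner_actLin_nonneg hM2 u
  rw [actLin_sub, actLin_smul, actLin_mul, inner_sub_left, inner_smul_left,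
    inner_actLin_comm hM (actLin M u), real_inner_self_eq_norm_sq] at this
  rw [norm_sub_sq_real, real_inner_comm]
  simp at this
  linarith

lemma actLin_const {M : Matrix (Fin m) (Fin m) ℝ} (hM : M.mulVec 1 = 0)
    (x : EuclideanSpace ℝ (Fin p)) : actLin M (WithLp.toLp 2 fun _ => x) = 0 := by
  ext i c
  rw [actLin_apply_apply]
  have h : (fun _ : Fin m => x c) = x c • (1 : Fin m → ℝ) := by ext; simp
  change M.mulVec (fun _ => x c) i = 0
  rw [h, Matrix.mulVec_smul, hM]
  simp

lemma actLin_eq_self {A : Matrix (Fin m) (Fin m) ℝ}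
    (hA : ∀ v : Fin m → ℝ, ∑ i, v i = 0 → A.mulVec v = v) {u : StackSpace m p}
    (hu : ∑ i, u i = 0) : actLin A u = u := by
  ext i c
  rw [actLin_apply_apply, hA]
  have := congrArg (fun x : EuclideanSpace ℝ (Fin p) => x c) hu
  simpa using this

lemma sum_act_eq_zero {M : Matrix (Fin m) (Fin m) ℝ} (hM : M.IsHermitian)
    (hM1 : M.mulVec 1 = 0) (x : Stack m p) : ∑ i, act M x i = 0 := by
  simp only [act]
  rw [Finset.sum_comm]
  refine Finset.sum_eq_zero fun j _ => ?_
  rw [← Finset.sum_smul]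
  have h1 : ∀ i, M i j = M j i := fun i => by simpa using hM.apply j i
  have h2 := congrFun hM1 j
  simp only [Matrix.mulVec, dotProduct, Pi.one_apply, mul_one, Pi.zero_apply] at h2
  simp [h1, h2]

end Stacks

namespace Problem

variable {p m n : ℕ} (P : Problem p m n)

/-- The objective on stacked variables. -/
def stackF (u : StackSpace m p) : ℝ := ∑ i, P.loc i (u i)

/-- The gradient of the objective on stacked variables. -/
def stackG (u : StackSpace m p) : StackSpace m p :=
  WithLp.toLp 2 fun i => gradient (P.loc i) (u i)

lemma bregman_stack (u v : StackSpace m p) :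
    bregman P.stackF P.stackG u v =
      ∑ i, bregman (P.loc i) (gradient (P.loc i)) (u i) (v i) := by
  simp only [bregman, stackF, stackG, PiLp.inner_apply, Finset.sum_sub_distrib]
  rfl

variable {P}

lemma L_le_Lf (i : Fin m) : P.L i ≤ P.Lf := le_ciSup (Set.finite_range _).bddAbove i

lemma Lbar_le_LbarF (i : Fin m) : P.Lbar i ≤ P.LbarF := le_ciSup (Set.finite_range _).bddAbove i

lemma le_bregman_stack (hf : P.FunctionAssumptions) (u v : StackSpace m p) :
    P.μ / 2 * ‖u - v‖ ^ 2 ≤ bregman P.stackF P.stackG u v := by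
  rw [bregman_stack, PiLp.norm_sq_eq_of_L2, Finset.mul_sum]
  exact Finset.sum_le_sum fun i _ =>
    le_bregman_of_strongConvexOn (hf.loc_smooth i).1 (hf.loc_strong i) _ _

lemma bregman_stack_le (hf : P.FunctionAssumptions) (u v : StackSpace m p) :
    bregman P.stackF P.stackG u v ≤ P.Lf / 2 * ‖u - v‖ ^ 2 := by
  rw [bregman_stack, PiLp.norm_sq_eq_of_L2, Finset.mul_sum]
  refine Finset.sum_le_sum fun i _ => ((hf.loc_smooth i).bregman_le _ _).trans ?_
  have := P.L_le_Lf i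
  exact mul_le_mul_of_nonneg_right (by linarith) (sq_nonneg _)

/-! ### The sampling distribution -/

lemma Lbar_pos (hp : 1 ≤ p) (hf : P.FunctionAssumptions) (i : Fin m) : 0 < P.Lbar i :=
  (hf.mu_pos.trans_le (le_of_strongConvexOn_of_isSmoothWith hp (hf.loc_smooth i)
    (hf.loc_strong i))).trans_le (hf.L_le_Lbar i)

lemma prob_nonneg (hp : 1 ≤ p) (hf : P.FunctionAssumptions) (i : Fin m) (j : Fin n) : 0 ≤ P.prob i j :=
  div_nonneg ((hf.comp_smooth i j).nonneg hp)
    (Finset.sum_nonneg fun j' _ => (hf.comp_smooth i j').nonneg hp)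

lemma prob_eq (hn : 1 ≤ n) (i : Fin m) (j : Fin n) : P.prob i j = P.Lc i j / (n * P.Lbar i) := by
  have : (n : ℝ) ≠ 0 := by positivity
  rw [prob, Lbar]; congr 1; field_simp

lemma sum_prob (hp : 1 ≤ p) (hn : 1 ≤ n) (hf : P.FunctionAssumptions)
    (i : Fin m) : ∑ j, P.prob i j = 1 := by
  have h := Lbar_pos hp hf i
  have : 0 < (n : ℝ) := by positivity
  rw [Lbar] at h
  have h' : 0 < ∑ j, P.Lc i j := pos_of_mul_pos_right h (by positivity)
  simp only [prob]
  rw [← Finset.sum_div, div_self h'.ne']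

lemma isProbabilityMeasure_sampleLaw_of_assumptions (hp : 1 ≤ p) (hn : 1 ≤ n) (hf : P.FunctionAssumptions)
    (i : Fin m) :
    IsProbabilityMeasure (P.sampleLaw i) :=
  P.isProbabilityMeasure_sampleLaw (prob_nonneg hp hf i) (sum_prob hp hn hf i)

/-- One term of the gradient estimator. -/
def sampleGrad (P : Problem p m n) (i : Fin m) (y w : EuclideanSpace ℝ (Fin p)) (j : Fin n) :
    EuclideanSpace ℝ (Fin p) :=
  (1 / ((n : ℝ) * P.prob i j)) • (gradient (P.f i j) y - gradient (P.f i j) w)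

lemma gradient_sub_eq_zero (hf : P.FunctionAssumptions) {i : Fin m} {j : Fin n} (h : P.Lc i j = 0)
    (y w : EuclideanSpace ℝ (Fin p)) : gradient (P.f i j) y - gradient (P.f i j) w = 0 := by
  have := (hf.comp_smooth i j).2 w y
  rw [h, zero_mul] at this
  exact norm_eq_zero.1 (le_antisymm this (norm_nonneg _))

lemma integral_sampleGrad (hp : 1 ≤ p) (hn : 1 ≤ n) (hf : P.FunctionAssumptions)
    (i : Fin m) (y w : EuclideanSpace ℝ (Fin p)) :
    ∫ j, P.sampleGrad i y w j ∂(P.sampleLaw i) =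
      gradient (P.loc i) y - gradient (P.loc i) w := by
  rw [P.integral_sampleLaw (prob_nonneg hp hf i), gradient_loc hf, gradient_loc hf, ← smul_sub,
    ← Finset.sum_sub_distrib, Finset.smul_sum]
  refine Finset.sum_congr rfl fun j _ => ?_
  by_cases h : P.Lc i j = 0
  · rw [sampleGrad, gradient_sub_eq_zero hf h]; simp
  · have hL := (Lbar_pos hp hf i).ne'
    have : (n : ℝ) ≠ 0 := by positivity
    rw [sampleGrad, smul_smul, prob_eq hn]
    congr 1
    field_simp

/-- Sampling proportionally to L_{i,j} cancels the factor L_{i,j} of cocoercivity, leaving the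
average L̄_i rather than the largest constant. The Bregman distance is based at y, to match the term
that `step_descent` subtracts. -/
lemma integral_norm_sampleGrad_sq_le (hp : 1 ≤ p) (hn : 1 ≤ n) (hf : P.FunctionAssumptions)
    (i : Fin m) (y w : EuclideanSpace ℝ (Fin p)) :
    ∫ j, ‖P.sampleGrad i y w j‖ ^ 2 ∂(P.sampleLaw i) ≤
      2 * P.Lbar i * bregman (P.loc i) (gradient (P.loc i)) w y := by
  rw [P.integral_sampleLaw (prob_nonneg hp hf i), bregman_loc hf, ← mul_assoc, Finset.mul_sum]
  refine Finset.sum_le_sum fun j _ => ?_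
  have hL := Lbar_pos hp hf i
  have hn' : 0 < (n : ℝ) := by positivity
  have h1 := norm_gradient_sub_sq_le hp hf i j w y
  have h2 := le_bregman_of_strongConvexOn (hf.comp_smooth i j).1
      (strongConvexOn_zero.2 (hf.comp_convex i j)) w y
  rw [zero_div, zero_mul] at h2
  rcases ((hf.comp_smooth i j).nonneg hp).eq_or_lt with h | h
  · rw [sampleGrad, gradient_sub_eq_zero hf h.symm]
    simp only [smul_zero, norm_zero]
    norm_num
    positivity
  · rw [sampleGrad, norm_smul, norm_sub_rev, mul_pow, Real.norm_eq_abs, sq_abs, smul_eq_mul,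
      prob_eq hn]
    calc P.Lc i j / (n * P.Lbar i) * ((1 / (n * (P.Lc i j / (n * P.Lbar i)))) ^ 2 *
          ‖gradient (P.f i j) w - gradient (P.f i j) y‖ ^ 2)
        = P.Lbar i / (n * P.Lc i j) * ‖gradient (P.f i j) w - gradient (P.f i j) y‖ ^ 2 := by
          field_simp
      _ ≤ P.Lbar i / (n * P.Lc i j) * (2 * P.Lc i j *
            bregman (P.f i j) (gradient (P.f i j)) w y) := by gcongr
      _ = _ := by field_simp

/-- The error of the gradient estimator of one node, as a function of its samples. -/
def estimatorError (P : Problem p m n) (s : State m p) (i : Fin m) (S : Fin P.b → Fin n) :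
    EuclideanSpace ℝ (Fin p) :=
  (1 / (P.b : ℝ)) • ∑ l : Fin P.b, P.sampleGrad i (P.yPt s i) (s.w i) (S l)
    - (gradient (P.loc i) (P.yPt s i) - gradient (P.loc i) (s.w i))

lemma integral_estimatorError (hp : 1 ≤ p) (hn : 1 ≤ n) (hf : P.FunctionAssumptions)
    (hb : 0 < P.b) (s : State m p) (i : Fin m) :
    ∫ S, P.estimatorError s i S ∂(Measure.pi fun _ : Fin P.b => P.sampleLaw i) = 0 := by
  have := isProbabilityMeasure_sampleLaw_of_assumptions hp hn hf i
  unfold estimatorError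
  rw [integral_sub Integrable.of_finite Integrable.of_finite, integral_miniBatch _ hb,
    integral_sampleGrad hp hn hf]
  simp

lemma integral_norm_estimatorError_sq_le (hp : 1 ≤ p) (hn : 1 ≤ n) (hf : P.FunctionAssumptions)
    (hb : 0 < P.b) (s : State m p) (i : Fin m) :
    ∫ S, ‖P.estimatorError s i S‖ ^ 2 ∂(Measure.pi fun _ : Fin P.b => P.sampleLaw i) ≤
      2 * P.LbarF / P.b * bregman (P.loc i) (gradient (P.loc i)) (s.w i) (P.yPt s i) := by
  have := isProbabilityMeasure_sampleLaw_of_assumptions hp hn hf i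
  have h1 := integral_norm_miniBatch_sub_sq_le (P.sampleLaw i) hb
    (P.sampleGrad i (P.yPt s i) (s.w i))
  have h2 := integral_norm_sampleGrad_sq_le hp hn hf i (P.yPt s i) (s.w i)
  rw [integral_sampleGrad hp hn hf] at h1
  refine h1.trans ?_
  have h3 := P.Lbar_le_LbarF i
  have h4 := le_bregman_of_strongConvexOn (hf.loc_smooth i).1 (hf.loc_strong i)
    (s.w i) (P.yPt s i)
  have h5 : 0 ≤ bregman (P.loc i) (gradient (P.loc i)) (s.w i) (P.yPt s i) :=
    le_trans (by have := hf.mu_pos; positivity) h4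
  have hb' : 0 < (P.b : ℝ) := by positivity
  calc _ ≤ 1 / (P.b : ℝ) * (2 * P.LbarF *
        bregman (P.loc i) (gradient (P.loc i)) (s.w i) (P.yPt s i)) := by
        gcongr; exact h2.trans (by gcongr)
    _ = _ := by ring

lemma estimator_eq (d : P.Draw) (s : State m p) (i : Fin m) :
    P.estimator d s i = gradient (P.loc i) (P.yPt s i) + P.estimatorError s i (d i).1 := by
  unfold estimatorError estimator sampleGrad
  abel

end Problem

end AccVRExtra

/-! ### Parameter relations, the Lyapunov function and its pathwise decrease. -/

namespace AccVRExtra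

open scoped RealInnerProductSpace
open MeasureTheory

namespace Problem

variable {p m n : ℕ} {P : Problem p m n}

/-- The relations between the parameters of the algorithm that enter the analysis. -/
structure ParameterBounds (P : Problem p m n) : Prop where
  Lf_pos : 0 < P.Lf
  mu_le : 3 * P.μ ≤ P.Lf
  θ₁_pos : 0 < P.θ₁
  θ₁_le : P.θ₁ ≤ 1 / 2
  θ₁_sq : P.θ₁ ^ 2 = 3 * P.μ / (4 * P.Lf)
  θ₂_nonneg : 0 ≤ P.θ₂
  add_le_one : P.θ₁ + P.θ₂ ≤ 1
  b_pos : 0 < P.b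
  b_le : P.b ≤ n
  θ₁_le_refresh : 2 / 3 * P.θ₁ ≤ (P.b : ℝ) / n
  θ₂_le_refresh : 2 / 3 * P.θ₂ ≤ (P.b : ℝ) / n
  b_mul_le : (P.b : ℝ) * √P.kappaB ≤ 2 * (√((n : ℝ) * P.kappaS) + n)

lemma parameterBounds (hm : 2 ≤ m) (hn : 1 ≤ n) (hf : P.FunctionAssumptions)
    (hκ₁ : 3 ≤ P.kappaB)
    (hκ₂ : 3 ≤ max ((n : ℝ) * P.kappaB / P.kappaS) ((n : ℝ) ^ 2 * P.kappaB / P.kappaS ^ 2)) :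
    P.ParameterBounds := by
  have hμ := hf.mu_pos
  have hn0 : 0 < (n : ℝ) := by positivity
  have hμL : 3 * P.μ ≤ P.Lf := by rwa [kappaB, le_div_iff₀ hμ] at hκ₁
  have hL : 0 < P.Lf := by linarith
  have : Nonempty (Fin m) := ⟨⟨0, by omega⟩⟩
  have hLL : P.Lf ≤ P.LbarF := ciSup_mono (Set.finite_range _).bddAbove hf.L_le_Lbar
  have hLb : 0 < P.LbarF := by linarith
  -- Both alternatives of the hypothesis give this: the first directly, the second after squaring,
  -- with 3μ ≤ L_f. It yields n ≥ 3 and 1 ≤ X ≤ (n/3)², hence √X ≤ b ≤ min(n, 2√X).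
  have hnL : 3 * P.LbarF ≤ n * P.Lf := by
    rcases le_max_iff.1 hκ₂ with h | h
    · have : (n : ℝ) * P.kappaB / P.kappaS = n * P.Lf / P.LbarF := by
        rw [kappaB, kappaS]; field_simp
      rwa [this, le_div_iff₀ hLb] at h
    · have : (n : ℝ) ^ 2 * P.kappaB / P.kappaS ^ 2 = n ^ 2 * P.Lf * P.μ / P.LbarF ^ 2 := by
        rw [kappaB, kappaS]; field_simp
      rw [this, le_div_iff₀ (by positivity)] at h
      have h1 : (n : ℝ) ^ 2 * P.Lf * (3 * P.μ) ≤ n ^ 2 * P.Lf * P.Lf := by gcongr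
      refine le_of_pow_le_pow_left₀ two_ne_zero (by positivity) ?_
      nlinarith
  have hn3 : (3 : ℝ) ≤ n := by
    by_contra h
    push Not at h
    nlinarith
  set X := (n : ℝ) * max P.LbarF (n * P.μ) / (3 * P.Lf) with hX
  have hbX : √X ≤ P.b := Nat.le_ceil _
  have hbX' : (P.b : ℝ) < √X + 1 := Nat.ceil_lt_add_one (Real.sqrt_nonneg _)
  have hX1 : n * P.LbarF / (3 * P.Lf) ≤ X := by
    rw [hX]; gcongr; exact le_max_left _ _
  have hX2 : n * (n * P.μ) / (3 * P.Lf) ≤ X := by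
    rw [hX]; gcongr; exact le_max_right _ _
  have hX0 : 1 ≤ X := by
    refine le_trans ?_ hX1
    rw [le_div_iff₀ (by positivity)]
    nlinarith
  have hX3 : X ≤ (n / 3) ^ 2 := by
    rw [hX, div_le_iff₀ (by positivity)]
    have : max P.LbarF (n * P.μ) ≤ n * P.Lf / 3 := max_le (by linarith) (by nlinarith)
    calc (n : ℝ) * max P.LbarF (n * P.μ) ≤ n * (n * P.Lf / 3) := by gcongr
      _ = _ := by ring
  have hsX : 1 ≤ √X := Real.one_le_sqrt.2 hX0
  have hb0 : 0 < (P.b : ℝ) := by linarith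
  have hbsq : X ≤ (P.b : ℝ) ^ 2 := by
    calc X = √X ^ 2 := (Real.sq_sqrt (by linarith)).symm
      _ ≤ _ := by gcongr
  have hθsq : P.θ₁ ^ 2 = 3 * P.μ / (4 * P.Lf) := by
    rw [θ₁, mul_pow, Real.sq_sqrt (by positivity)]; field_simp; norm_num
  have hθpos : 0 < P.θ₁ := by rw [θ₁]; positivity
  have hθle : P.θ₁ ≤ 1 / 2 := by
    refine le_of_pow_le_pow_left₀ two_ne_zero (by norm_num) ?_
    rw [hθsq, div_le_iff₀ (by positivity)]; linarith
  have hθ₂pos : 0 ≤ P.θ₂ := by rw [θ₂]; positivity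
  have hθ₂le : P.θ₂ ≤ 1 / 2 := by
    have h1 : P.LbarF ≤ P.Lf * P.b := by
      refine le_of_pow_le_pow_left₀ two_ne_zero (by positivity) ?_
      rw [mul_pow]
      have h2 : P.Lf ^ 2 * (n * P.LbarF / (3 * P.Lf)) ≤ P.Lf ^ 2 * (P.b : ℝ) ^ 2 := by
        gcongr; exact hX1.trans hbsq
      have h3 : P.Lf ^ 2 * (n * P.LbarF / (3 * P.Lf)) = P.LbarF * (n * P.Lf) / 3 := by
        field_simp
      nlinarith
    rw [θ₂, div_le_iff₀ (by positivity)]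
    linarith
  refine ⟨hL, hμL, hθpos, hθle, hθsq, hθ₂pos, by linarith, by exact_mod_cast hb0, ?_, ?_, ?_, ?_⟩
  · have h1 : √X ≤ n / 3 := Real.sqrt_le_iff.2 ⟨by positivity, hX3⟩
    have h2 : (P.b : ℝ) < n + 1 := by linarith
    have h3 : P.b < n + 1 := by exact_mod_cast h2
    omega
  -- The branch nμ of the maximum in b serves θ₁; the branch L̄_f serves θ₂ in the next item.
  · refine le_of_pow_le_pow_left₀ two_ne_zero (by positivity) ?_
    rw [mul_pow, hθsq, div_pow (P.b : ℝ), le_div_iff₀ (by positivity)]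
    have : (2 / 3 : ℝ) ^ 2 * (3 * P.μ / (4 * P.Lf)) * n ^ 2 = n * (n * P.μ) / (3 * P.Lf) := by
      field_simp; norm_num
    rw [this]
    exact hX2.trans hbsq
  · rw [θ₂, le_div_iff₀ hn0]
    have h1 : n * P.LbarF / (3 * P.Lf) ≤ (P.b : ℝ) ^ 2 := hX1.trans hbsq
    have h2 : 2 / 3 * (P.LbarF / (2 * P.Lf * P.b)) * n = n * P.LbarF / (3 * P.Lf) / P.b := by
      field_simp
    rw [h2, div_le_iff₀ hb0]
    nlinarith
  · have h1 : (P.b : ℝ) ≤ 2 * √X := by linarith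
    have h2 : √X * √P.kappaB ≤ √((n : ℝ) * P.kappaS) + n := by
      rw [← Real.sqrt_mul (by linarith)]
      have h3 : X * P.kappaB ≤ n * P.kappaS + n ^ 2 := by
        have h4 : X * P.kappaB = n * max P.LbarF (n * P.μ) / (3 * P.μ) := by
          rw [hX, kappaB]; field_simp
        have h5 : n * P.kappaS + n ^ 2 = n * (P.LbarF + n * P.μ) / P.μ := by
          rw [kappaS]; field_simp
        rw [h4, h5]
        have h6 : max P.LbarF (n * P.μ) ≤ P.LbarF + n * P.μ :=
          max_le (by nlinarith) (by linarith)
        gcongr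
        linarith
      have h7 : 0 ≤ n * P.kappaS := by rw [kappaS]; positivity
      refine (Real.sqrt_le_sqrt h3).trans ?_
      rw [Real.sqrt_le_left (by positivity)]
      nlinarith [Real.sq_sqrt h7, Real.sqrt_nonneg (n * P.kappaS)]
    calc (P.b : ℝ) * √P.kappaB ≤ 2 * √X * √P.kappaB := by gcongr
      _ = 2 * (√X * √P.kappaB) := by ring
      _ ≤ _ := by gcongr

/-- The consensus stack at a point. -/
def consensus (m : ℕ) (xs : EuclideanSpace ℝ (Fin p)) : StackSpace m p := WithLp.toLp 2 fun _ => xs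

/-- The optimal dual variable. -/
def dualOpt (P : Problem p m n) (xs : EuclideanSpace ℝ (Fin p)) : StackSpace m p :=
  -(P.α • P.stackG (consensus m xs))

/-- The weight of the snapshot in the Lyapunov function. -/
def snapshotWeight (P : Problem p m n) : ℝ := P.θ₂ / ((P.b : ℝ) / n - P.θ₁ / 6)

/-- The primal-dual part of the Lyapunov function. -/
def lyapQuad (P : Problem p m n) (R : Matrix (Fin m) (Fin m) ℝ) (xs : EuclideanSpace ℝ (Fin p))
    (s : State m p) : ℝ :=
  5 * P.Lf * ⟪actLin R (WithLp.toLp 2 s.lam - P.dualOpt xs), WithLp.toLp 2 s.lam - P.dualOpt xs⟫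
    + 5 * P.Lf * P.θ₁ ^ 2 *
      compNormSq (actLin (chebMatrix P.W)) (WithLp.toLp 2 s.z - consensus m xs)

/-- The Lyapunov function of the algorithm; `R` is a pseudo-inverse of the Chebyshev matrix. -/
def lyap (P : Problem p m n) (R : Matrix (Fin m) (Fin m) ℝ) (xs : EuclideanSpace ℝ (Fin p))
    (s : State m p) : ℝ :=
  (1 - P.snapshotWeight * ((P.b : ℝ) / n)) *
      bregman P.stackF P.stackG (WithLp.toLp 2 s.x) (consensus m xs)
    + P.snapshotWeight * bregman P.stackF P.stackG (WithLp.toLp 2 s.w) (consensus m xs)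
    + (1 + P.θ₁ / 50) * P.lyapQuad R xs s

/-- The fluctuation of the snapshot of one node around its mean. -/
def coinNoise (P : Problem p m n) (xs : EuclideanSpace ℝ (Fin p)) (d : P.Draw) (s : State m p)
    (i : Fin m) : ℝ :=
  bregman (P.loc i) (gradient (P.loc i)) ((P.step d s).w i) xs
    - (P.b : ℝ) / n * bregman (P.loc i) (gradient (P.loc i)) (P.xNext d s i) xs
    - (1 - (P.b : ℝ) / n) * bregman (P.loc i) (gradient (P.loc i)) (s.w i) xs

lemma integral_coinNoise (hb : P.b ≤ n) (hs : ∀ i, IsProbabilityMeasure (P.sampleLaw i))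
    (xs : EuclideanSpace ℝ (Fin p)) (s : State m p) (i : Fin m) :
    ∫ d, P.coinNoise xs d s i ∂P.drawLaw = 0 := by
  set β : EuclideanSpace ℝ (Fin p) → ℝ := fun u => bregman (P.loc i) (gradient (P.loc i)) u xs
  -- The new x of node i depends only on the samples of that node, so the other entries and the coin
  -- value `true` are dummies.
  have h := P.integral_drawLaw_eval hb hs i fun S c =>
    β (if c = true then P.xNext (fun _ => (S, true)) s i else s.w i)
      - (P.b : ℝ) / n * β (P.xNext (fun _ => (S, true)) s i) - (1 - (P.b : ℝ) / n) * β (s.w i)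
  refine Eq.trans ?_ (h.trans ?_)
  · rfl
  · rw [← integral_zero (Fin P.b → Fin n) ℝ (μ := Measure.pi fun _ : Fin P.b => P.sampleLaw i)]
    congr 1
    ext S
    simp only [if_true, Bool.false_eq_true, if_false]
    ring

/-- The spectral properties of the Chebyshev matrix and of its pseudo-inverse `R`. -/
structure IsPseudoInverse (M R : Matrix (Fin m) (Fin m) ℝ) : Prop where
  psd : M.PosSemidef
  le_half : ((1 / 2 : ℝ) • 1 - M).PosSemidef
  sq_le : ((2 : ℝ) • M - M * M).PosSemidef
  mulVec_one : M.mulVec 1 = 0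
  psd' : R.PosSemidef
  le' : ((5 / 2 : ℝ) • 1 - R).PosSemidef
  mul_eq : ∀ v : Fin m → ℝ, ∑ i, v i = 0 → (M * R).mulVec v = v

/-- Supplies the two facts about R needed in `primal_dual_identity`. It applies only to stacks of
sum zero, which is why the multipliers must keep that property. -/
lemma IsPseudoInverse.inner_eq {M R : Matrix (Fin m) (Fin m) ℝ} (h : IsPseudoInverse M R)
    {v : StackSpace m p} (hv : ∑ i, v i = 0) (u : StackSpace m p) :
    ⟪v, actLin R (actLin M u)⟫ = ⟪v, u⟫ := by
  rw [← inner_actLin_comm h.psd'.1, ← inner_actLin_comm h.psd.1, ← actLin_mul,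
    actLin_eq_self h.mul_eq hv]

/-- The error of the gradient estimator at all nodes. -/
def stackError (P : Problem p m n) (d : P.Draw) (s : State m p) : StackSpace m p :=
  WithLp.toLp 2 fun i => P.estimatorError s i (d i).1

/-- Pathwise decrease of the Lyapunov function up to noise. -/
lemma lyap_step_le {R : Matrix (Fin m) (Fin m) ℝ} (hf : P.FunctionAssumptions)
    (hP : P.ParameterBounds) (hR : IsPseudoInverse (chebMatrix P.W) R)
    {xs : EuclideanSpace ℝ (Fin p)} (hx : ∀ x, ∑ i, P.loc i xs ≤ ∑ i, P.loc i x)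
    {s : State m p} (hs : ∑ i, s.lam i = 0) (d : P.Draw) :
    P.lyap R xs (P.step d s) ≤ (1 + P.θ₁ / 50)⁻¹ * P.lyap R xs s
      + P.snapshotWeight * ∑ i, P.coinNoise xs d s i
      + (-(P.θ₁ * ∑ i, ⟪P.estimatorError s i (d i).1, s.z i - xs⟫)
        + (1 / (4 * P.Lf) * ∑ i, ‖P.estimatorError s i (d i).1‖ ^ 2 - P.θ₂ *
          bregman P.stackF P.stackG (WithLp.toLp 2 s.w) (WithLp.toLp 2 (P.yPt s)))) := by
  have hsum : ∀ x : Stack m p, ∑ i, act (chebMatrix P.W) x i = 0 :=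
    sum_act_eq_zero hR.psd.1 hR.mulVec_one
  have hg0 := sum_gradient_loc_eq_zero hf hx
  have hα : P.α = 1 / (10 * P.Lf) := rfl
  have hα0 : 0 < P.α := by rw [hα]; have := hP.Lf_pos; positivity
  -- The multipliers sum to zero, and so do the local gradients at the minimizer.
  have hν : ∑ i, (WithLp.toLp 2 (P.step d s).lam - P.dualOpt xs) i = 0 := by
    have : ∀ i, (WithLp.toLp 2 (P.step d s).lam - P.dualOpt xs) i = s.lam i
        + P.θ₁ • act (chebMatrix P.W) (P.zNext d s) i + P.α • gradient (P.loc i) xs := by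
      intro i
      simp [dualOpt, step, stackG, consensus]
    simp only [this, Finset.sum_add_distrib, ← Finset.smul_sum, hs, hsum, hg0]
    simp
  -- The explicit z-update, multiplied by θ₁ and rearranged as an optimality condition.
  have hz : P.α • (WithLp.toLp 2 (P.estimator d s) : StackSpace m p) + WithLp.toLp 2 s.lam
      + P.θ₁ • actLin (chebMatrix P.W) (WithLp.toLp 2 s.z)
      + P.θ₁ • (WithLp.toLp 2 (P.zNext d s) - WithLp.toLp 2 s.z)
      + (P.μ * P.α) • (WithLp.toLp 2 (P.zNext d s) - WithLp.toLp 2 (P.yPt s)) = 0 := by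
    have hθ := hP.θ₁_pos.ne'
    ext1 i
    change P.α • P.estimator d s i + s.lam i + P.θ₁ • act (chebMatrix P.W) s.z i
      + P.θ₁ • (P.zNext d s i - s.z i) + (P.μ * P.α) • (P.zNext d s i - P.yPt s i) = 0
    have h0 : 0 < 1 + P.μ * P.α / P.θ₁ := by
      have := hf.mu_pos; have := hP.θ₁_pos; positivity
    have h1 : (1 + P.μ * P.α / P.θ₁) • P.zNext d s i = (P.μ * P.α / P.θ₁) • P.yPt s i + s.z i -
        (1 / P.θ₁) • (P.α • P.estimator d s i + s.lam i
          + P.θ₁ • act (chebMatrix P.W) s.z i) := by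
      rw [zNext, smul_smul, mul_one_div_cancel h0.ne', one_smul]
    have h2 := congrArg (fun v => P.θ₁ • v) h1
    simp only [smul_sub, smul_add, smul_smul, mul_div_cancel₀ _ hθ, one_smul, add_smul] at h2
    rw [← sub_eq_zero] at h2
    have h4 : P.θ₁ * (1 / P.θ₁ * P.α) = P.α := by field_simp
    have h5 : P.θ₁ * (1 / P.θ₁ * P.θ₁) = P.θ₁ := by field_simp
    simp only [h4, h5] at h2
    rw [← h2]
    module
  have key := step_descent (F := P.stackF) (G := P.stackG) (M := actLin (chebMatrix P.W))
    (R := actLin R) (x := WithLp.toLp 2 s.x) (z := WithLp.toLp 2 s.z) (w := WithLp.toLp 2 s.w)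
    (y := WithLp.toLp 2 (P.yPt s)) (zn := WithLp.toLp 2 (P.zNext d s))
    (xn := WithLp.toLp 2 (P.xNext d s)) (g := WithLp.toLp 2 (P.estimator d s))
    (xs := consensus m xs) (lam := WithLp.toLp 2 s.lam) (lamn := WithLp.toLp 2 (P.step d s).lam)
    (ν := P.dualOpt xs) (α := P.α)
    hP.Lf_pos hf.mu_pos hP.mu_le hP.θ₁_pos hP.θ₁_le hP.add_le_one hP.θ₁_sq
    (le_bregman_stack hf) (bregman_stack_le hf) (inner_actLin_comm hR.psd.1)
    (inner_actLin_comm hR.psd'.1) (inner_actLin_nonneg hR.psd) (inner_actLin_le hR.le_half)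
    (norm_sub_actLin_sq_le hR.psd.1 hR.sq_le) (inner_actLin_le hR.le') hα
    (actLin_const hR.mulVec_one xs)
    (fun u v => hR.inner_eq (hsum v.ofLp) u) (hR.inner_eq hν) rfl rfl rfl rfl hz
  have he : WithLp.toLp 2 (P.estimator d s) - P.stackG (WithLp.toLp 2 (P.yPt s)) =
      P.stackError d s := by
    ext1 i
    change P.estimator d s i - gradient (P.loc i) (P.yPt s i) = P.estimatorError s i (d i).1
    rw [estimator_eq, add_sub_cancel_left]
  have hi : ⟪P.stackError d s, WithLp.toLp 2 s.z - consensus m xs⟫ =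
      ∑ i, ⟪P.estimatorError s i (d i).1, s.z i - xs⟫ := PiLp.inner_apply _ _
  rw [he, PiLp.norm_sq_eq_of_L2, hi] at key
  have hbn : ∀ u v : StackSpace m p, 0 ≤ bregman P.stackF P.stackG u v := fun u v =>
    le_trans (by have := hf.mu_pos; positivity) (le_bregman_stack hf u v)
  have hcomb := lyapunov_combine
    (fw' := bregman P.stackF P.stackG (WithLp.toLp 2 (P.step d s).w) (consensus m xs))
    (Q := P.lyapQuad R xs s) (Q' := P.lyapQuad R xs (P.step d s)) hP.θ₁_pos hP.θ₁_le hP.θ₂_nonneg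
    hP.add_le_one hP.θ₁_le_refresh hP.θ₂_le_refresh (B := P.snapshotWeight) rfl
    (hbn (WithLp.toLp 2 s.x) (consensus m xs)) (hbn (WithLp.toLp 2 s.w) (consensus m xs))
    (fx' := bregman P.stackF P.stackG (WithLp.toLp 2 (P.step d s).x) (consensus m xs))
    (N := -(P.θ₁ * ∑ i, ⟪P.estimatorError s i (d i).1, s.z i - xs⟫)
        + (1 / (4 * P.Lf) * ∑ i, ‖P.estimatorError s i (d i).1‖ ^ 2 - P.θ₂ *
          bregman P.stackF P.stackG (WithLp.toLp 2 s.w) (WithLp.toLp 2 (P.yPt s))))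
    (le_of_le_of_eq key (by unfold lyapQuad stackError; ring))
  have hnoise : bregman P.stackF P.stackG (WithLp.toLp 2 (P.step d s).w) (consensus m xs)
      - (P.b : ℝ) / n * bregman P.stackF P.stackG (WithLp.toLp 2 (P.step d s).x) (consensus m xs)
      - (1 - (P.b : ℝ) / n) * bregman P.stackF P.stackG (WithLp.toLp 2 s.w) (consensus m xs)
      = ∑ i, P.coinNoise xs d s i := by
    simp only [bregman_stack, Finset.mul_sum, ← Finset.sum_sub_distrib]
    rfl
  rw [hnoise] at hcomb
  exact hcomb

end Problem

end AccVRExtra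

/-! ### Expected linear convergence and the iteration count. -/

namespace AccVRExtra

open scoped RealInnerProductSpace
open MeasureTheory

namespace Problem

variable {p m n : ℕ} {P : Problem p m n}

/-- Expected decrease of the Lyapunov function. -/
lemma integral_lyap_step_le {R : Matrix (Fin m) (Fin m) ℝ} (hp : 1 ≤ p) (hn : 1 ≤ n)
    (hf : P.FunctionAssumptions) (hP : P.ParameterBounds)
    (hR : IsPseudoInverse (chebMatrix P.W) R)
    {xs : EuclideanSpace ℝ (Fin p)} (hx : ∀ x, ∑ i, P.loc i xs ≤ ∑ i, P.loc i x)
    {s : State m p} (hs : ∑ i, s.lam i = 0) :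
    ∫ d, P.lyap R xs (P.step d s) ∂P.drawLaw ≤ (1 + P.θ₁ / 50)⁻¹ * P.lyap R xs s := by
  have hsm := isProbabilityMeasure_sampleLaw_of_assumptions hp hn hf
  have := P.isProbabilityMeasure_drawLaw hP.b_le hsm
  have hL := hP.Lf_pos
  have hb : 0 < (P.b : ℝ) := by exact_mod_cast hP.b_pos
  refine (integral_mono Integrable.of_finite Integrable.of_finite
    (lyap_step_le hf hP hR hx hs)).trans ?_
  set D := bregman P.stackF P.stackG (WithLp.toLp 2 s.w) (WithLp.toLp 2 (P.yPt s)) with hD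
  have h1 : ∫ d, ∑ i, P.coinNoise xs d s i ∂P.drawLaw = 0 := by
    rw [integral_finsetSum _ fun _ _ => Integrable.of_finite]
    exact Finset.sum_eq_zero fun i _ => integral_coinNoise hP.b_le hsm xs s i
  have h2 : ∫ d : P.Draw, ∑ i, ⟪P.estimatorError s i (d i).1, s.z i - xs⟫ ∂P.drawLaw = 0 := by
    rw [integral_finsetSum _ fun _ _ => Integrable.of_finite]
    refine Finset.sum_eq_zero fun i _ => ?_
    rw [P.integral_drawLaw_samples hP.b_le hsm i fun S => ⟪P.estimatorError s i S, s.z i - xs⟫]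
    simp only [real_inner_comm (s.z i - xs)]
    rw [integral_inner Integrable.of_finite, integral_estimatorError hp hn hf hP.b_pos,
      inner_zero_right]
  have h3 : ∫ d : P.Draw, ∑ i, ‖P.estimatorError s i (d i).1‖ ^ 2 ∂P.drawLaw ≤
      2 * P.LbarF / P.b * D := by
    rw [integral_finsetSum _ fun _ _ => Integrable.of_finite, hD, bregman_stack, Finset.mul_sum]
    refine Finset.sum_le_sum fun i _ => ?_
    rw [P.integral_drawLaw_samples hP.b_le hsm i fun S => ‖P.estimatorError s i S‖ ^ 2]
    exact integral_norm_estimatorError_sq_le hp hn hf hP.b_pos s i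
  -- The definition of θ₂ makes the variance bound cancel the Bregman term exactly.
  have h4 : 1 / (4 * P.Lf) * (2 * P.LbarF / P.b * D) = P.θ₂ * D := by
    rw [θ₂]; field_simp; norm_num
  have h5 := mul_le_mul_of_nonneg_left h3 (show 0 ≤ 1 / (4 * P.Lf) by positivity)
  rw [integral_add Integrable.of_finite Integrable.of_finite,
    integral_add Integrable.of_finite Integrable.of_finite,
    integral_add Integrable.of_finite Integrable.of_finite,
    integral_sub Integrable.of_finite Integrable.of_finite, integral_neg, integral_const,
    integral_const, integral_const_mul, integral_const_mul, integral_const_mul, h1, h2]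
  simp only [probReal_univ, one_smul]
  linarith

/-- Every update of the multipliers lies in the range of M, which is orthogonal to consensus. -/
lemma sum_lam_run {M : Matrix (Fin m) (Fin m) ℝ} (hM : M = chebMatrix P.W)
    (hM0 : M.IsHermitian) (hM1 : M.mulVec 1 = 0) (x₀ : Stack m p) (k : ℕ)
    (ω : Fin k → P.Draw) : ∑ i, (P.run x₀ k ω).lam i = 0 := by
  subst hM
  induction k with
  | zero => simp [run, init]
  | succ k ih =>
    simp only [run, step, Finset.sum_add_distrib, ← Finset.smul_sum, sum_act_eq_zero hM0 hM1, ih]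
    simp

lemma expect_lyap_le {R : Matrix (Fin m) (Fin m) ℝ} (hp : 1 ≤ p) (hn : 1 ≤ n)
    (hf : P.FunctionAssumptions) (hP : P.ParameterBounds)
    (hR : IsPseudoInverse (chebMatrix P.W) R)
    {xs : EuclideanSpace ℝ (Fin p)} (hx : ∀ x, ∑ i, P.loc i xs ≤ ∑ i, P.loc i x)
    (x₀ : Stack m p) (k : ℕ) :
    P.expect x₀ k (P.lyap R xs) ≤
      (1 + P.θ₁ / 50)⁻¹ ^ k * P.lyap R xs (init (n := n) x₀) := by
  have hsm := isProbabilityMeasure_sampleLaw_of_assumptions hp hn hf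
  have hθ := hP.θ₁_pos
  induction k with
  | zero => rw [expect_zero]; simp
  | succ k ih =>
    rw [P.expect_succ hP.b_le hsm]
    calc _ ≤ P.expect x₀ k fun s => (1 + P.θ₁ / 50)⁻¹ * P.lyap R xs s :=
          P.expect_mono hP.b_le hsm x₀ k fun ω => integral_lyap_step_le hp hn hf hP hR hx
            (sum_lam_run rfl hR.psd.1 hR.mulVec_one x₀ k ω)
      _ = (1 + P.θ₁ / 50)⁻¹ * P.expect x₀ k (P.lyap R xs) := P.expect_const_mul _ _ _ _
      _ ≤ (1 + P.θ₁ / 50)⁻¹ * ((1 + P.θ₁ / 50)⁻¹ ^ k * P.lyap R xs (init (n := n) x₀)) := by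
          gcongr
      _ = _ := by ring

/-- All parts of the Lyapunov function are nonnegative, and its z-part has coefficient 5L_f θ₁² =
15μ/4 in a metric I - M ⪰ 1/2. -/
lemma sum_norm_sub_sq_le_lyap {R : Matrix (Fin m) (Fin m) ℝ}
    (hf : P.FunctionAssumptions) (hP : P.ParameterBounds)
    (hR : IsPseudoInverse (chebMatrix P.W) R) (xs : EuclideanSpace ℝ (Fin p)) (s : State m p) :
    ∑ i, ‖s.z i - xs‖ ^ 2 ≤ 8 / (15 * P.μ) * P.lyap R xs s := by
  have hμ := hf.mu_pos
  have hL := hP.Lf_pos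
  have hθ := hP.θ₁_pos
  have hbn : ∀ u v : StackSpace m p, 0 ≤ bregman P.stackF P.stackG u v := fun u v =>
    le_trans (by positivity) (le_bregman_stack hf u v)
  have hq : 0 < (P.b : ℝ) / n - P.θ₁ / 6 := by have := hP.θ₁_le_refresh; linarith
  have hB0 : 0 ≤ P.snapshotWeight := div_nonneg hP.θ₂_nonneg hq.le
  have hBq : P.snapshotWeight * ((P.b : ℝ) / n) ≤ 1 := by
    have h1 : P.snapshotWeight * ((P.b : ℝ) / n - P.θ₁ / 6) = P.θ₂ := div_mul_cancel₀ _ hq.ne'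
    have h2 : P.snapshotWeight ≤ 2 := by
      rw [snapshotWeight, div_le_iff₀ hq]
      linarith [hP.θ₁_le_refresh, hP.θ₂_le_refresh]
    nlinarith [hP.add_le_one]
  have hn : ∑ i, ‖s.z i - xs‖ ^ 2 = ‖WithLp.toLp 2 s.z - consensus m xs‖ ^ 2 := by
    rw [PiLp.norm_sq_eq_of_L2]; rfl
  have h5 : 5 * P.Lf * P.θ₁ ^ 2 = 15 * P.μ / 4 := by rw [hP.θ₁_sq]; field_simp; norm_num
  have hM := inner_actLin_le hR.le_half (WithLp.toLp 2 s.z - consensus m xs)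
  have hQ : 15 * P.μ / 8 * ‖WithLp.toLp 2 s.z - consensus m xs‖ ^ 2 ≤ P.lyapQuad R xs s := by
    have h6 := inner_actLin_nonneg hR.psd' (WithLp.toLp 2 s.lam - P.dualOpt xs)
    have h7 : 0 ≤ 5 * P.Lf * ⟪actLin R (WithLp.toLp 2 s.lam - P.dualOpt xs),
      WithLp.toLp 2 s.lam - P.dualOpt xs⟫ := by positivity
    unfold lyapQuad compNormSq
    rw [h5]
    nlinarith
  have hQ0 : 0 ≤ P.lyapQuad R xs s := le_trans (by positivity) hQ
  have hl : P.lyapQuad R xs s ≤ P.lyap R xs s := by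
    have a1 := mul_nonneg (sub_nonneg.2 hBq) (hbn (WithLp.toLp 2 s.x) (consensus m xs))
    have a2 := mul_nonneg hB0 (hbn (WithLp.toLp 2 s.w) (consensus m xs))
    have a3 : 0 ≤ P.θ₁ / 50 * P.lyapQuad R xs s := by positivity
    unfold lyap
    linarith
  rw [hn, div_mul_eq_mul_div, le_div_iff₀ (by positivity)]
  linarith

lemma inv_θ₁_le (hμ : 0 < P.μ) (hP : P.ParameterBounds) : 1 / P.θ₁ ≤ 2 * √P.kappaB := by
  have hL := hP.Lf_pos
  rw [div_le_iff₀ hP.θ₁_pos]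
  refine le_of_pow_le_pow_left₀ two_ne_zero (by have := hP.θ₁_pos; positivity) ?_
  rw [mul_pow, mul_pow, hP.θ₁_sq, Real.sq_sqrt (by rw [kappaB]; positivity), kappaB]
  field_simp
  norm_num

end Problem

lemma IsGossipMatrix.exists_isPseudoInverse {m : ℕ} {G : SimpleGraph (Fin m)}
    {W : Matrix (Fin m) (Fin m) ℝ} (hW : IsGossipMatrix G W) (hm : 2 ≤ m) :
    ∃ R, Problem.IsPseudoInverse (chebMatrix W) R := by
  obtain ⟨h1, h2, h3, h4, R, h5, h6, h7⟩ := hW.chebMatrix_spectrum hm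
  exact ⟨R, h1, h2, h3, h4, h5, h6, h7⟩

/-- The number of iterations needed to make a geometric sequence small. -/
lemma exists_iterations {θ c : ℝ} (hθ : 0 < θ) (hθ' : θ ≤ 1 / 2) (hc : 0 ≤ c) {ε : ℝ}
    (hε : 0 < ε) (hε' : ε < 1 / (c + 3)) :
    1 ≤ Real.log (1 / ε) ∧ ∃ K : ℕ, (K : ℝ) ≤ 201 * (1 / θ) * Real.log (1 / ε) ∧
      ∀ k, K ≤ k → c * (1 + θ / 50)⁻¹ ^ k ≤ ε := by
  have h1 : c + 3 < 1 / ε := by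
    rw [lt_div_iff₀ (by positivity)] at hε'
    rw [lt_div_iff₀ hε]; linarith
  set l := Real.log (1 / ε) with hl
  have hl1 : 1 ≤ l := by
    rw [hl, Real.le_log_iff_exp_le (by positivity)]
    have := Real.exp_one_lt_d9
    linarith
  refine ⟨hl1, ⌈200 / θ * l⌉₊, ?_, ?_⟩
  · have h2 : (⌈200 / θ * l⌉₊ : ℝ) < 200 / θ * l + 1 := Nat.ceil_lt_add_one (by positivity)
    have h3 : 1 ≤ 1 / θ * l := by
      have : 1 ≤ 1 / θ := by rw [le_div_iff₀ hθ]; linarith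
      nlinarith
    have h4 : 200 / θ * l = 200 * (1 / θ * l) := by ring
    linarith
  · intro k hk
    have hk' : 200 / θ * l ≤ k := (Nat.le_ceil _).trans (by exact_mod_cast hk)
    have h2 : (1 + θ / 50)⁻¹ ≤ Real.exp (-(θ / 100)) := by
      have h3 : (1 + θ / 50)⁻¹ ≤ 1 - θ / 100 := by
        rw [← one_div, div_le_iff₀ (by positivity)]; nlinarith
      have := Real.add_one_le_exp (-(θ / 100))
      linarith
    -- Aiming at ε² leaves a spare factor ε, which absorbs the initial constant c since cε ≤ 1.
    have h3 : (1 + θ / 50)⁻¹ ^ k ≤ ε ^ 2 := by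
      calc (1 + θ / 50)⁻¹ ^ k ≤ Real.exp (-(θ / 100)) ^ k := by gcongr
        _ = Real.exp (-(k * (θ / 100))) := by rw [← Real.exp_nat_mul]; congr 1; ring
        _ ≤ Real.exp (-(2 * l)) := by
          apply Real.exp_le_exp.2
          have : 200 / θ * l * (θ / 100) ≤ k * (θ / 100) := by gcongr
          have h5 : 200 / θ * l * (θ / 100) = 2 * l := by field_simp; norm_num
          linarith
        _ = ε ^ 2 := by
          have : -(2 * l) = Real.log ε + Real.log ε := by
            rw [hl, one_div, Real.log_inv]; ring
          rw [this, Real.exp_add, Real.exp_log hε]; ring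
    have h6 : c * ε ≤ 1 := by
      rw [lt_div_iff₀ hε] at h1; nlinarith
    calc c * (1 + θ / 50)⁻¹ ^ k ≤ c * ε ^ 2 := by gcongr
      _ = c * ε * ε := by ring
      _ ≤ 1 * ε := by gcongr
      _ = ε := one_mul _

end AccVRExtra

end

theorem mainTheorem1 :
    ∃ C : ℝ, 0 < C ∧
      ∀ (p m n : ℕ) (_hp : 1 ≤ p) (_hm : 2 ≤ m) (_hn : 1 ≤ n)
        (P : AccVRExtra.Problem p m n) (G : SimpleGraph (Fin m))
        (_hf : P.FunctionAssumptions) (_hW : AccVRExtra.IsGossipMatrix G P.W)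
        (_hκ₁ : 3 ≤ P.kappaB)
        (_hκ₂ : 3 ≤ max ((n : ℝ) * P.kappaB / P.kappaS) ((n : ℝ) ^ 2 * P.kappaB / P.kappaS ^ 2))
        (xstar : EuclideanSpace ℝ (Fin p))
        (_hx : ∀ x, ∑ i, P.loc i xstar ≤ ∑ i, P.loc i x)
        (x₀ : AccVRExtra.Stack m p),
        ∃ ε₀ : ℝ, 0 < ε₀ ∧ ∀ ε : ℝ, 0 < ε → ε < ε₀ →
          ∃ K : ℕ,
            (∀ k, K ≤ k → P.expect x₀ k (fun s => ∑ i, ‖s.z i - xstar‖ ^ 2) ≤ ε) ∧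
            (∀ ω, ((P.run x₀ K ω).rounds : ℝ) ≤
              C * (√(P.kappaB * AccVRExtra.kappaC P.W) * Real.log (1 / ε))) ∧
            (∀ i, P.expect x₀ K (fun s => (s.evals i : ℝ)) ≤
              C * ((√((n : ℝ) * P.kappaS) + n) * Real.log (1 / ε))) := by
  -- Any constant above 402 · 8 = 3216 (rounds) and 1 + 1206 · 2 = 2413 (gradients) would do.
  refine ⟨4000, by norm_num, ?_⟩
  intro p m n hp hm hn P G hf hW hκ₁ hκ₂ xs hx x₀
  have hP := AccVRExtra.Problem.parameterBounds hm hn hf hκ₁ hκ₂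
  have hsm := AccVRExtra.Problem.isProbabilityMeasure_sampleLaw_of_assumptions hp hn hf
  obtain ⟨R, hR⟩ := hW.exists_isPseudoInverse hm
  have hμ := hf.mu_pos
  have hz := AccVRExtra.Problem.sum_norm_sub_sq_le_lyap hf hP hR xs
  set Ψ := P.lyap R xs
  set c := 8 / (15 * P.μ) * Ψ (AccVRExtra.Problem.init (n := n) x₀) with hc
  have hc0 : 0 ≤ c := le_trans (Finset.sum_nonneg fun i _ => sq_nonneg _) (hz _)
  have hexp : ∀ k, P.expect x₀ k (fun s => ∑ i, ‖s.z i - xs‖ ^ 2) ≤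
      c * (1 + P.θ₁ / 50)⁻¹ ^ k := by
    intro k
    calc _ ≤ P.expect x₀ k fun s => 8 / (15 * P.μ) * Ψ s :=
          P.expect_mono hP.b_le hsm x₀ k fun ω => hz _
      _ = 8 / (15 * P.μ) * P.expect x₀ k Ψ := P.expect_const_mul _ _ _ _
      _ ≤ 8 / (15 * P.μ) * ((1 + P.θ₁ / 50)⁻¹ ^ k *
            Ψ (AccVRExtra.Problem.init (n := n) x₀)) := by
          gcongr; exact AccVRExtra.Problem.expect_lyap_le hp hn hf hP hR hx x₀ k
      _ = _ := by rw [hc]; ring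
  -- 3 > e forces log(1/ε) ≥ 1, which pays for rounding up K and for the n initial gradients.
  refine ⟨1 / (c + 3), by positivity, fun ε hε hε' => ?_⟩
  obtain ⟨hl, K, hK, hKε⟩ := AccVRExtra.exists_iterations hP.θ₁_pos hP.θ₁_le hc0 hε hε'
  set l := Real.log (1 / ε)
  have hK' : (K : ℝ) ≤ 402 * √P.kappaB * l := by
    have := AccVRExtra.Problem.inv_θ₁_le hμ hP
    refine hK.trans ?_
    have : 201 * (1 / P.θ₁) ≤ 402 * √P.kappaB := by linarith
    gcongr
  refine ⟨K, fun k hk => (hexp k).trans (hKε k hk), fun ω => ?_, fun i => ?_⟩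
  · rw [P.rounds_run, Real.sqrt_mul (by linarith)]
    push_cast
    have ht := hW.chebDeg_le hm
    calc (K : ℝ) * (2 * AccVRExtra.chebDeg P.W)
        ≤ 402 * √P.kappaB * l * (2 * (4 * √(AccVRExtra.kappaC P.W))) := by gcongr
      _ = 3216 * (√P.kappaB * √(AccVRExtra.kappaC P.W) * l) := by ring
      _ ≤ _ := by gcongr; norm_num
  · rw [P.expect_evals hn hP.b_le hsm]
    have hb := hP.b_mul_le
    set A := √((n : ℝ) * P.kappaS) + n
    have hA : (n : ℝ) ≤ A := le_add_of_nonneg_left (Real.sqrt_nonneg _)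
    have hA0 : 0 ≤ A := le_trans (by positivity) hA
    calc (n : ℝ) + 3 * P.b * K ≤ A * 1 + 3 * P.b * (402 * √P.kappaB * l) := by
          rw [mul_one]; gcongr
      _ = A * 1 + 1206 * (P.b * √P.kappaB) * l := by ring
      _ ≤ A * l + 1206 * (2 * A) * l := by gcongr
      _ = 2413 * (A * l) := by ring
      _ ≤ _ := by gcongr; norm_num
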